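/- Let $a>0$, $\gamma\in\mathbb R$ and $\alpha>0$. For $x>0$ the series $$f(x)=\sum_{k=0}^{\infty}(k+a)^{\gamma}e^{-(k+a)^{\alpha}x}$$ converges. Let $\zeta(s,a)$ be the Hurwitz zeta function, that is, the analytic continuation to $\mathbb C\setminus\{1\}$ of $\sum_{k\ge 0}(k+a)^{-s}$, $\operatorname{Re}s>1$, and put $$c_k=\frac{(-1)^k}{k!}\,\zeta(-\alpha k-\gamma,a)$$ for all integers $k\ge 0$ with $-\alpha k-\gamma\neq 1$. (i) If $-\frac{\gamma+1}{\alpha}$ is not a nonnegative integer, put $$g(x)=\frac1\alpha\,\Gamma\!\left(\frac{\gamma+1}{\alpha}\right)x^{-\frac{\gamma+1}{\alpha}}.$$ Then, as $x\to+0$, $$f(x)\sim g(x)+\sum_{k=0}^{\infty}c_kx^k .$$ (ii) If $-\frac{\gamma+1}{\alpha}=r$ is a nonnegative integer, put $$g(x)=\frac{(-1)^rx^r}{\Gamma(r+1)}\left(-\frac{\ln x}{\alpha}+\frac1\alpha\,\frac{\Gamma'(r+1)}{\Gamma(r+1)}-\frac{\Gamma'(a)}{\Gamma(a)}\right).$$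 Then, as $x\to+0$, $$f(x)\sim g(x)+\sum_{k=0,\;k\ne r}^{\infty}c_kx^k .$$ Here $f(x)\sim g(x)+\sum_{k}c_kx^k$ means that for every integer $N\ge 0$ $$f(x)-g(x)-\sum_{k<N}c_kx^k=O(x^N),\qquad x\to+0,$$ where in case (ii) the index $k=r$ is omitted from the sum. Moreover, if $0<\alpha<1$, then in both cases the series on the right converges and the relation is an equality for every $x>0$; if $\alpha=1$, the same is true for every $x\in(0,2\pi)$. -/

import Mathlib

open Filter Topology Asymptotics

/-- The general term `(k + a) ^ γ * exp (-(k + a) ^ α * x)`. -/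
noncomputable def expTerm (a γ α x : ℝ) (k : ℕ) : ℝ :=
  ((k : ℝ) + a) ^ γ * Real.exp (-((k : ℝ) + a) ^ α * x)

/-- The sum `f(x, a, γ, α)` of the series over all `k ≥ 0`. -/
noncomputable def expSeries (a γ α x : ℝ) : ℝ := ∑' k : ℕ, expTerm a γ α x k

/-- The Hurwitz zeta function `ζ(s, a)` for an arbitrary real parameter `a > 0`, continued to
`ℂ \ {1}`.  Mathlib's `hurwitzZeta` only depends on `a` modulo `1` and corresponds to the
representative of `a` in `(0, 1]`; the finitely many terms with `(a - 1), …, (a - m)`, where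
`a - m ∈ (0, 1]`, are removed from it.
The next two lemmas show that this is the analytic continuation of `∑ 1 / (k + a) ^ s`. -/
noncomputable def hurwitzZetaPos (s : ℂ) (a : ℝ) : ℂ :=
  HurwitzZeta.hurwitzZeta (a : UnitAddCircle) s -
    ∑ j ∈ Finset.range (⌈a⌉₊ - 1), 1 / (((a - ((j : ℝ) + 1) : ℝ) : ℂ) ^ s)

/-- For `Re s > 1` the function is the sum of the defining series. -/
theorem hasSum_hurwitzZetaPos {a : ℝ} (ha : 0 < a) {s : ℂ} (hs : 1 < s.re) :
    HasSum (fun k : ℕ => 1 / (((k : ℝ) + a : ℝ) : ℂ) ^ s) (hurwitzZetaPos s a) := by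
  obtain ⟨m, hm⟩ : ∃ m : ℕ, ⌈a⌉₊ = m + 1 :=
    Nat.exists_eq_succ_of_ne_zero (Nat.ceil_pos.mpr ha).ne'
  have h1 : a ≤ m + 1 := by
    have := Nat.le_ceil a
    rw [hm] at this
    exact_mod_cast this
  have h2 : (m : ℝ) < a := Nat.lt_ceil.mp (by omega)
  have h3 := HurwitzZeta.hasSum_hurwitzZeta_of_one_lt_re (a := a - m)
    ⟨by linarith, by linarith⟩ hs
  have h4 : ((a - m : ℝ) : UnitAddCircle) = (a : UnitAddCircle) := by
    rw [AddCircle.coe_sub]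
    have : ((m : ℝ) : UnitAddCircle) = 0 := by
      rw [AddCircle.coe_eq_zero_iff]
      exact ⟨m, by simp⟩
    rw [this, sub_zero]
  rw [h4, ← hasSum_nat_add_iff' m] at h3
  unfold hurwitzZetaPos
  rw [hm, Nat.add_sub_cancel]
  have e1 : (fun k : ℕ => 1 / (((k : ℝ) + a : ℝ) : ℂ) ^ s) =
      fun k : ℕ => 1 / (((k + m : ℕ) : ℂ) + ((a - m : ℝ) : ℂ)) ^ s := by
    funext k
    push_cast
    ring_nf
  have e2 : ∑ j ∈ Finset.range m, 1 / (((a - ((j : ℝ) + 1) : ℝ) : ℂ) ^ s) =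
      ∑ j ∈ Finset.range m, 1 / ((j : ℂ) + ((a - m : ℝ) : ℂ)) ^ s := by
    rw [← Finset.sum_range_reflect]
    refine Finset.sum_congr rfl fun j hj => ?_
    have hj' : j + 1 ≤ m := Finset.mem_range.mp hj
    rw [Nat.sub_sub, Nat.add_comm 1 j]
    push_cast [Nat.cast_sub hj']
    ring_nf
  rw [e1, e2]
  exact h3

/-- The function is holomorphic on `ℂ \ {1}`. -/
theorem differentiableAt_hurwitzZetaPos {a : ℝ} {s : ℂ} (hs : s ≠ 1) :
    DifferentiableAt ℂ (fun z => hurwitzZetaPos z a) s := by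
  unfold hurwitzZetaPos
  refine (HurwitzZeta.differentiableAt_hurwitzZeta _ hs).sub ?_
  refine DifferentiableAt.fun_sum fun j hj => ?_
  have h : (((j + 1 : ℕ) : ℝ)) < a := by
    have := Finset.mem_range.mp hj
    exact Nat.lt_ceil.mp (by omega)
  have h0 : (((a - ((j : ℝ) + 1) : ℝ)) : ℂ) ≠ 0 := by
    push_cast at h
    exact_mod_cast (by linarith : (0 : ℝ) < a - ((j : ℝ) + 1)).ne'
  refine (differentiableAt_const _).div (differentiableAt_id.const_cpow (Or.inl h0)) ?_
  exact fun h' => h0 ((Complex.cpow_eq_zero_iff _ _).mp h').1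

/-- The power-series term `((-1) ^ k / k!) * ζ(-α k - γ, a) * x ^ k`. -/
noncomputable def zetaTerm (a γ α x : ℝ) (k : ℕ) : ℂ :=
  (-1) ^ k / (Nat.factorial k : ℂ) * hurwitzZetaPos ((-α * k - γ : ℝ) : ℂ) a * (x : ℂ) ^ k

/-- The singular term `(1 / α) Γ((γ + 1) / α) x ^ (-(γ + 1) / α)` of the generic case. -/
noncomputable def gammaTerm (γ α x : ℝ) : ℝ :=
  1 / α * Real.Gamma ((γ + 1) / α) * x ^ (-((γ + 1) / α))

/-- The logarithmic term that replaces the term of index `r` when `-(γ + 1) / α = r`. -/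
noncomputable def logTerm (a α : ℝ) (r : ℕ) (x : ℝ) : ℝ :=
  (-1) ^ r * x ^ r / Real.Gamma (r + 1) *
    (-Real.log x / α + deriv Real.Gamma (r + 1) / Real.Gamma (r + 1) * (1 / α)
      - deriv Real.Gamma a / Real.Gamma a)

/-- `f(x) ~ g(x) + ∑ k, c x k` as `x → +0`, where `c x k` is a constant multiple of `x ^ k`:
after subtraction of `g` and of the terms with `k < N`, the remainder is `O(x ^ N)`,
for every `N`. -/
def HasExpansionAtZero (f g : ℝ → ℝ) (c : ℝ → ℕ → ℂ) : Prop :=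
  ∀ N : ℕ, (fun x : ℝ => (f x : ℂ) - ((g x : ℂ) + ∑ k ∈ Finset.range N, c x k))
    =O[𝓝[>] (0 : ℝ)] fun x : ℝ => x ^ N

/-!
Put `b = a + 1/2` and `φ(z) = z ^ γ * exp (-x z ^ α)`, so that the series is `φ(a)` plus the sum of
`φ` over the midpoints `b + 1/2 + k`.  The midpoint form of the Abel–Plana formula
(`abelPlana_hasSum`) expresses the latter sum as `∫ φ` over `(b, ∞)` minus a correction term
`rayIntegral`: the integral of `φ` over two conjugate rays issuing from `b`, against the kernel
`1 / (exp (∓2πi(z - b)) + 1)`, which decays exponentially along the rays.  The expansion is obtained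
by inserting the exponential series `φ(z) = ∑ (-x) ^ k / k! * z ^ (γ + α k)` into the three pieces.

* The same formula for the powers `z ^ (-s)` gives Hermite's formula `hurwitzZetaPos_eq` for the
  zeta function at every `s ≠ 1`, by analytic continuation in `s`.  Hence the `k`-th terms of the
  three pieces add up to the `k`-th zeta term (`expansionTerm_eq_zetaTerm`).
* The integral over `(b, ∞)` is an incomplete Gamma function, whose classical expansion supplies the
  singular term (`hasSum_incompleteTerm_of_ne`), with a logarithm when `-(γ + 1) / α` is a natural
  number `r` (`hasSum_incompleteTerm_of_eq`).  In that case the pole of the zeta function at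
  `1` is replaced by the value of the correction term at the exponent `-1`, which produces
  `Γ'(a) / Γ(a)` (`rayIntegral_cpow_neg_one`).
* In the correction term, the rays are taken so close to the real axis that `Re z ^ α ≥ 0` on them;
  then the Taylor remainder of the exponential is `O(x ^ N |z| ^ (α N))`, and integration against
  the kernel gives the asymptotic expansion (`rayIntegral_powExp_isBigO`).  For `α ≤ 1` the rays may
  be vertical, the kernel decays like `exp (-2πt)`, and the whole exponential series may be
  integrated termwise if `exp (x |z| ^ α)` grows more slowly, that is, if `α < 1`, or if `α = 1` and
  `x < 2π` (`hasSum_rayIntegral_powExp`).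
-/

open MeasureTheory Set ComplexConjugate

/-! ### The kernel -/

/-- The kernel `1 / (exp (-2πiw) + 1)` of the midpoint Abel–Plana formula.  It is `1`-periodic,
decays exponentially for `Im w → +∞`, and has simple poles at the half-integers. -/
noncomputable def midpointKernel (w : ℂ) : ℂ :=
  (Complex.exp (-(2 * Real.pi * Complex.I * w)) + 1)⁻¹

theorem midpointKernel_one_add (w : ℂ) : midpointKernel (1 + w) = midpointKernel w := by
  unfold midpointKernel
  rw [show -(2 * Real.pi * Complex.I * (1 + w)) =
    -(2 * Real.pi * Complex.I * w) - 2 * Real.pi * Complex.I by ring, Complex.exp_periodic.sub_eq]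

theorem exp_eq_neg_one_of_midpoint {w : ℂ} (h : Complex.exp (-(2 * Real.pi * Complex.I * w)) = -1) :
    ∃ n : ℤ, w = 1 / 2 + n := by
  rw [← Complex.exp_pi_mul_I, Complex.exp_eq_exp_iff_exists_int] at h
  obtain ⟨n, hn⟩ := h
  refine ⟨-n - 1, ?_⟩
  have hpi : (Real.pi : ℂ) * Complex.I ≠ 0 := by simp [Real.pi_ne_zero]
  apply mul_left_cancel₀ hpi
  push_cast
  linear_combination (-1 / 2) * hn

theorem norm_midpointKernel_le {w : ℂ} (hw : 1 ≤ 2 * Real.pi * w.im) :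
    ‖midpointKernel w‖ ≤ 2 * Real.exp (-(2 * Real.pi * w.im)) := by
  have h1 : ‖Complex.exp (-(2 * Real.pi * Complex.I * w))‖ = Real.exp (2 * Real.pi * w.im) := by
    rw [Complex.norm_exp]; simp
  have h2 : 2 ≤ Real.exp (2 * Real.pi * w.im) := by
    have := Real.add_one_le_exp (2 * Real.pi * w.im)
    linarith
  have h3 : Real.exp (2 * Real.pi * w.im) / 2 ≤
      ‖Complex.exp (-(2 * Real.pi * Complex.I * w)) + 1‖ := by
    have := norm_sub_le_norm_add (Complex.exp (-(2 * Real.pi * Complex.I * w))) 1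
    rw [h1, norm_one] at this
    linarith
  unfold midpointKernel
  rw [norm_inv, Real.exp_neg]
  calc _ ≤ (Real.exp (2 * Real.pi * w.im) / 2)⁻¹ := by
        apply inv_anti₀ (by positivity) h3
    _ = _ := by rw [inv_div, div_eq_mul_inv]

theorem exp_midpoint_add_one_ne_zero_of_ray {e : ℂ} (he : 0 < e.im) (t : ℝ) :
    Complex.exp (-(2 * Real.pi * Complex.I * (t * e))) + 1 ≠ 0 := by
  intro h
  obtain ⟨n, hn⟩ := exp_eq_neg_one_of_midpoint (eq_neg_of_add_eq_zero_left h)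
  have h1 := congrArg Complex.im hn
  have h2 := congrArg Complex.re hn
  simp [he.ne'] at h1
  simp [h1] at h2
  have h3 : (0 : ℝ) = ((1 + 2 * n : ℤ) : ℝ) := by push_cast; linarith
  have h4 : (0 : ℤ) = 1 + 2 * n := by exact_mod_cast h3
  omega

theorem continuous_midpointKernel_ray {e : ℂ} (he : 0 < e.im) :
    Continuous fun t : ℝ => midpointKernel (t * e) := by
  unfold midpointKernel
  exact Continuous.inv₀ (by fun_prop) (exp_midpoint_add_one_ne_zero_of_ray he)

theorem exists_norm_midpointKernel_ray_le {e : ℂ} (he : 0 < e.im) :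
    ∃ M : ℝ, 0 < M ∧ ∀ t : ℝ, 0 ≤ t →
      ‖midpointKernel (t * e)‖ ≤ M * Real.exp (-(2 * Real.pi * e.im * t)) := by
  set T := 1 / (2 * Real.pi * e.im)
  obtain ⟨M, hM⟩ := (isCompact_Icc (a := (0 : ℝ)) (b := T)).exists_bound_of_continuousOn
    (f := fun t : ℝ => midpointKernel (t * e) * Real.exp (2 * Real.pi * e.im * t))
    ((continuous_midpointKernel_ray he).mul (by fun_prop)).continuousOn
  refine ⟨max M 2, by positivity, fun t ht => ?_⟩
  rcases le_total t T with h | h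
  · have := hM t ⟨ht, h⟩
    rw [norm_mul, Complex.norm_real, Real.norm_eq_abs, Real.abs_exp] at this
    rw [Real.exp_neg, ← div_eq_mul_inv, le_div_iff₀ (Real.exp_pos _)]
    exact this.trans (le_max_left _ _)
  · have h1 : 1 ≤ 2 * Real.pi * (t * e).im := by
      rw [div_le_iff₀ (by positivity)] at h
      simp
      linarith
    refine (norm_midpointKernel_le h1).trans ?_
    have : (t * e).im = t * e.im := by simp
    rw [this, show 2 * Real.pi * (t * e.im) = 2 * Real.pi * e.im * t by ring]
    gcongr
    exact le_max_right _ _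

theorem integrableOn_one_add_pow_mul_exp_neg (p : ℕ) {c : ℝ} (hc : 0 < c) :
    IntegrableOn (fun t : ℝ => (1 + t) ^ p * Real.exp (-(c * t))) (Ioi 0) := by
  apply integrable_of_isBigO_exp_neg (b := c / 2) (by positivity) (by fun_prop)
  have h1 : (fun t : ℝ => (1 + t) ^ p) =O[atTop] fun t => Real.exp (c / 2 * (1 + t)) :=
    ((isLittleO_pow_exp_pos_mul_atTop p (by positivity : 0 < c / 2)).comp_tendsto
      (tendsto_atTop_add_const_left _ 1 tendsto_id)).isBigO
  have h2 : (fun t : ℝ => Real.exp (c / 2 * (1 + t)) * Real.exp (-(c * t))) =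
      fun t => Real.exp (c / 2) * Real.exp (-(c / 2) * t) := by
    funext t
    rw [← Real.exp_add, ← Real.exp_add]
    ring_nf
  have h3 := h1.mul (isBigO_refl (fun t : ℝ => Real.exp (-(c * t))) atTop)
  rw [h2] at h3
  exact h3.trans (isBigO_const_mul_self _ _ _)

/-! ### The Abel–Plana formula -/

theorem integral_segment_eq_sub {F q : ℂ → ℂ} {U : Set ℂ}
    (hF : ∀ z ∈ U, HasDerivAt F (q z) z) (hq : ContinuousOn q U) (p v : ℂ) {T : ℝ} (hT : 0 ≤ T)
    (h : ∀ t ∈ Icc 0 T, p + t * v ∈ U) :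
    v * ∫ t in (0 : ℝ)..T, q (p + t * v) = F (p + T * v) - F p := by
  rw [← intervalIntegral.integral_const_mul]
  have := intervalIntegral.integral_eq_sub_of_hasDerivAt (a := 0) (b := T)
    (f := fun t : ℝ => F (p + t * v)) (f' := fun t : ℝ => v * q (p + t * v)) ?_ ?_
  · simpa using this
  · intro t ht
    rw [uIcc_of_le hT] at ht
    have h1 : HasDerivAt (fun t : ℝ => p + t * v) v t := by
      simpa using ((Complex.ofRealCLM.hasDerivAt (x := t)).mul_const v).const_add p
    have := (hF _ (h t ht)).comp t h1
    rwa [mul_comm] at this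
  · apply ContinuousOn.intervalIntegrable
    rw [uIcc_of_le hT]
    exact continuousOn_const.mul (hq.comp (by fun_prop) h)

/-- Cauchy's theorem for a parallelogram with one horizontal side. -/
theorem integral_parallelogram {q : ℂ → ℂ} {U : Set ℂ} (hU : Convex ℝ U) (hUo : IsOpen U)
    (hq : DifferentiableOn ℂ q U) (p e : ℂ) {T : ℝ} (hT : 0 ≤ T)
    (h : ∀ u ∈ Icc (0 : ℝ) 1, ∀ t ∈ Icc 0 T, p + u + t * e ∈ U) :
    (∫ u in (0 : ℝ)..1, q (p + u)) + e * (∫ t in (0 : ℝ)..T, q (p + 1 + t * e)) =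
      e * (∫ t in (0 : ℝ)..T, q (p + t * e)) + ∫ u in (0 : ℝ)..1, q (p + u + T * e) := by
  obtain ⟨F, hF'⟩ := hU.exists_forall_hasDerivWithinAt hq
  have hF : ∀ z ∈ U, HasDerivAt F (q z) z := fun z hz =>
    (hF' z hz).hasDerivAt (hUo.mem_nhds hz)
  have hc := hq.continuousOn
  have h0 : (0 : ℝ) ∈ Icc 0 T := ⟨le_rfl, hT⟩
  have hT' : T ∈ Icc 0 T := ⟨hT, le_rfl⟩
  have i1 := integral_segment_eq_sub hF hc p 1 zero_le_one
    (fun u hu => by simpa using h u hu 0 h0)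
  have i2 := integral_segment_eq_sub hF hc (p + 1) e hT
    (fun t ht => by simpa using h 1 (by simp) t ht)
  have i3 := integral_segment_eq_sub hF hc p e hT
    (fun t ht => by simpa using h 0 (by simp) t ht)
  have i4 := integral_segment_eq_sub hF hc (p + T * e) 1 zero_le_one
    (fun u hu => by simpa [add_right_comm] using h u hu T hT')
  have e4 : (fun u : ℝ => q (p + T * e + u)) = fun u : ℝ => q (p + u + T * e) := by
    funext u; rw [add_right_comm]
  simp only [mul_one, one_mul, e4, Complex.ofReal_one] at i1 i4
  rw [i1, i2, i3, i4, show p + 1 + T * e = p + T * e + 1 by ring]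
  ring

theorem integrableOn_midpointKernel_mul {e : ℂ} (he : 0 < e.im) {ψ : ℝ → ℂ}
    (hψ : ContinuousOn ψ (Ioi 0)) {C : ℝ} {p : ℕ} (hC : ∀ t : ℝ, 0 < t → ‖ψ t‖ ≤ C * (1 + t) ^ p) :
    IntegrableOn (fun t : ℝ => midpointKernel (t * e) * ψ t) (Ioi 0) := by
  obtain ⟨M, hM0, hM⟩ := exists_norm_midpointKernel_ray_le he
  have hi := (integrableOn_one_add_pow_mul_exp_neg p
    (by positivity : 0 < 2 * Real.pi * e.im)).const_mul (M * C)
  refine Integrable.mono' hi ?_ ?_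
  · exact ((continuous_midpointKernel_ray he).continuousOn.mul hψ).aestronglyMeasurable
      measurableSet_Ioi
  · refine (ae_restrict_iff' measurableSet_Ioi).mpr (ae_of_all _ fun t ht => ?_)
    rw [norm_mul]
    calc _ ≤ (M * Real.exp (-(2 * Real.pi * e.im * t))) * (C * (1 + t) ^ p) :=
          mul_le_mul (hM t (le_of_lt ht)) (hC t ht) (norm_nonneg _) (by positivity)
      _ = _ := by ring

theorem re_pos_of_ray {b : ℝ} {e : ℂ} (hb : 0 < b) (he0 : 0 ≤ e.re) {t : ℝ} (ht : 0 ≤ t) :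
    0 < ((b : ℂ) + t * e).re := by
  simp
  positivity

/-- The strip between the two lines of direction `e` through `b - 1/2` and `b + 3/2`,
within the right half-plane. -/
def obliqueStrip (b : ℝ) (e : ℂ) : Set ℂ :=
  {z | 0 < z.re} ∩ {z | z.re * e.im - e.re * z.im < (b + 3 / 2) * e.im} ∩
    {z | (b - 1 / 2) * e.im < z.re * e.im - e.re * z.im}

theorem convex_obliqueStrip (b : ℝ) (e : ℂ) : Convex ℝ (obliqueStrip b e) := by
  have h : IsLinearMap ℝ fun z : ℂ => z.re * e.im - e.re * z.im :=
    ⟨fun x y => by simp; ring, fun c x => by simp; ring⟩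
  have h' : IsLinearMap ℝ fun z : ℂ => z.re := ⟨fun x y => by simp, fun c x => by simp⟩
  exact ((convex_halfSpace_gt h' _).inter (convex_halfSpace_lt h _)).inter (convex_halfSpace_gt h _)

theorem isOpen_obliqueStrip (b : ℝ) (e : ℂ) : IsOpen (obliqueStrip b e) := by
  refine ((isOpen_lt continuous_const Complex.continuous_re).inter
    (isOpen_lt ?_ continuous_const)).inter (isOpen_lt continuous_const ?_) <;> fun_prop

theorem mem_obliqueStrip {b : ℝ} {e : ℂ} (hb : 0 < b) (he0 : 0 ≤ e.re) (he : 0 < e.im) {u t : ℝ}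
    (hu : u ∈ Icc (0 : ℝ) 1) (ht : 0 ≤ t) : (b + u + t * e : ℂ) ∈ obliqueStrip b e := by
  have h1 := hu.1
  have h2 := hu.2
  refine ⟨⟨?_, ?_⟩, ?_⟩
  · simp
    positivity
  · simp
    nlinarith
  · simp
    nlinarith

/-- Within the strip, the only zero of the denominator of the kernel is the midpoint. -/
theorem eq_midpoint_of_mem_obliqueStrip {b : ℝ} {e : ℂ} (he : 0 < e.im) {z : ℂ}
    (hz : z ∈ obliqueStrip b e)
    (h : Complex.exp (-(2 * Real.pi * Complex.I * (z - b))) + 1 = 0) : z = b + 1 / 2 := by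
  obtain ⟨n, hn⟩ := exp_eq_neg_one_of_midpoint (eq_neg_of_add_eq_zero_left h)
  obtain ⟨⟨-, h2⟩, h3⟩ := hz
  have h4 : z = ((b + 1 / 2 + n : ℝ) : ℂ) := by push_cast; linear_combination hn
  simp only [mem_ofPred_eq, h4, Complex.ofReal_re, Complex.ofReal_im] at h2 h3
  have h5 : (n : ℝ) < 1 := by nlinarith
  have h6 : (-1 : ℝ) < n := by nlinarith
  have h7 : n < 1 := by exact_mod_cast h5
  have h8 : -1 < n := by exact_mod_cast h6
  obtain rfl : n = 0 := by omega
  rw [h4]; simp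

/-- The function `(φ(z) - φ(b + 1/2)) K(z - b)`, whose singularity at the midpoint
`b + 1/2` is removable, in the form of a holomorphic function. -/
theorem exists_differentiableOn_eq_mul_midpointKernel {φ : ℂ → ℂ} {b : ℝ} {e : ℂ} (hb : 0 < b)
    (he : 0 < e.im) (hφ : DifferentiableOn ℂ φ {z | 0 < z.re}) :
    ∃ q : ℂ → ℂ, DifferentiableOn ℂ q (obliqueStrip b e) ∧
      ∀ z : ℂ, z ≠ b + 1 / 2 → q z = (φ z - φ (b + 1 / 2)) * midpointKernel (z - b) := by
  set c : ℂ := b + 1 / 2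
  set E : ℂ → ℂ := fun z => Complex.exp (-(2 * Real.pi * Complex.I * (z - b))) + 1
  have hEd : Differentiable ℂ E := by unfold E; fun_prop
  have hexpc : Complex.exp (-(2 * Real.pi * Complex.I * (c - b))) = -1 := by
    rw [show -(2 * Real.pi * Complex.I * (c - b)) = -(Real.pi * Complex.I) by simp [c]; ring,
      Complex.exp_neg, Complex.exp_pi_mul_I]
    norm_num
  have hEc : E c = 0 := by simp only [E, hexpc]; ring
  have hEc' : deriv E c ≠ 0 := by
    have h1 : HasDerivAt E (Complex.exp (-(2 * Real.pi * Complex.I * (c - b))) *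
        (-(2 * Real.pi * Complex.I * 1))) c :=
      (((((hasDerivAt_id c).sub_const (b : ℂ)).const_mul _).neg).cexp).add_const 1
    rw [h1.deriv, hexpc]
    simp [Real.pi_ne_zero]
  have hc : c ∈ obliqueStrip b e := by
    have h3 : c = ((b + 1 / 2 : ℝ) : ℂ) := by simp [c]
    rw [h3]
    refine ⟨⟨?_, ?_⟩, ?_⟩
    · simp; positivity
    · simp; nlinarith
    · simp; nlinarith
  have hn : obliqueStrip b e ∈ 𝓝 c := (isOpen_obliqueStrip b e).mem_nhds hc
  refine ⟨fun z => dslope φ c z / dslope E c z, ?_, ?_⟩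
  · refine DifferentiableOn.div ?_ ?_ ?_
    · exact (Complex.differentiableOn_dslope hn).mpr (hφ.mono fun z hz => hz.1.1)
    · exact (Complex.differentiableOn_dslope hn).mpr hEd.differentiableOn
    · intro z hz
      by_cases hzc : z = c
      · rw [hzc, dslope_same]; exact hEc'
      · rw [dslope_of_ne _ hzc, slope_def_field, hEc, sub_zero]
        exact div_ne_zero (fun h => hzc (eq_midpoint_of_mem_obliqueStrip he hz h))
          (sub_ne_zero.mpr hzc)
  · intro z hz
    have hz' : z - c ≠ 0 := sub_ne_zero.mpr hz
    simp only [dslope_of_ne _ hz, slope_def_field, hEc, sub_zero, midpointKernel]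
    rw [div_div_div_cancel_right₀ hz', div_eq_mul_inv]

/-- One half of the midpoint Abel–Plana formula over a unit step: Cauchy's theorem for the
parallelogram with vertices `b`, `b + 1`, `b + 1 + Te`, `b + Te`, with `T → ∞`. -/
theorem abelPlana_step_upper {φ : ℂ → ℂ} {b : ℝ} {e : ℂ} {C : ℝ} {p : ℕ} (hb : 0 < b)
    (he0 : 0 ≤ e.re) (he : 0 < e.im) (hφ : DifferentiableOn ℂ φ {z | 0 < z.re})
    (hC : ∀ u t : ℝ, 0 ≤ u → 0 ≤ t → ‖φ (b + u + t * e)‖ ≤ C * (1 + t) ^ p) :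
    IntervalIntegrable (fun u : ℝ => (φ (b + u) - φ (b + 1 / 2)) * midpointKernel u) volume 0 1 ∧
    (∫ u in (0 : ℝ)..1, (φ (b + u) - φ (b + 1 / 2)) * midpointKernel u) +
      e * (∫ t in Ioi (0 : ℝ), midpointKernel (t * e) * φ (b + 1 + t * e)) =
      e * ∫ t in Ioi (0 : ℝ), midpointKernel (t * e) * φ (b + t * e) := by
  obtain ⟨q, hq, hq'⟩ := exists_differentiableOn_eq_mul_midpointKernel hb he hφ
  set c : ℂ := b + 1 / 2 with hcdef
  have hmem : ∀ T : ℝ, ∀ u ∈ Icc (0 : ℝ) 1, ∀ t ∈ Icc 0 T, (b : ℂ) + u + t * e ∈ obliqueStrip b e :=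
    fun T u hu t ht => mem_obliqueStrip hb he0 he hu ht.1
  have hpar := fun T hT => integral_parallelogram (convex_obliqueStrip b e)
    (isOpen_obliqueStrip b e) hq (b : ℂ) e (T := T) hT (hmem T)
  -- the bottom side
  have hae : ∀ᵐ u : ℝ, u ∈ uIoc (0 : ℝ) 1 →
      q (b + u) = (φ (b + u) - φ c) * midpointKernel u := by
    have : ∀ᵐ u : ℝ, u ≠ 1 / 2 := Measure.ae_ne volume (1 / 2)
    filter_upwards [this] with u hu _
    rw [hq', add_sub_cancel_left]
    intro h
    rw [hcdef] at h
    have h' := add_left_cancel h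
    exact hu (by simpa using congrArg Complex.re h')
  have hbi : IntervalIntegrable (fun u : ℝ => q (b + u)) volume 0 1 := by
    apply ContinuousOn.intervalIntegrable
    rw [uIcc_of_le zero_le_one]
    refine hq.continuousOn.comp (by fun_prop) fun u hu => ?_
    have := mem_obliqueStrip hb he0 he hu (le_refl (0 : ℝ))
    simpa using this
  have hside : ∀ t : ℝ, 0 ≤ t → ∀ u : ℝ, u = 0 ∨ u = 1 → (b : ℂ) + u + t * e ≠ c := by
    intro t ht u hu h
    rw [hcdef] at h
    have h1 := congrArg Complex.im h
    have h2 := congrArg Complex.re h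
    simp [he.ne'] at h1
    simp [h1] at h2
    rcases hu with rfl | rfl <;> norm_num at h2
  have hq0 : ∀ t : ℝ, 0 ≤ t → q (b + t * e) = midpointKernel (t * e) * (φ (b + t * e) - φ c) := by
    intro t ht
    rw [hq' _ (by simpa using hside t ht 0 (by simp)), add_sub_cancel_left, mul_comm]
  have hq1 : ∀ t : ℝ, 0 ≤ t →
      q (b + 1 + t * e) = midpointKernel (t * e) * (φ (b + 1 + t * e) - φ c) := by
    intro t ht
    rw [hq' _ (by simpa using hside t ht 1 (by simp)), add_assoc, add_sub_cancel_left, mul_comm,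
      midpointKernel_one_add]
  have hcont : ∀ u : ℝ, 0 ≤ u → ContinuousOn (fun t : ℝ => φ (b + u + t * e)) (Ioi 0) := by
    intro u hu
    refine hφ.continuousOn.comp (by fun_prop) fun t ht => ?_
    have := re_pos_of_ray (b := b + u) (e := e) (by positivity) he0 (le_of_lt ht)
    simpa using this
  have hint : ∀ u : ℝ, 0 ≤ u →
      IntegrableOn (fun t : ℝ => midpointKernel (t * e) * φ (b + u + t * e)) (Ioi 0) :=
    fun u hu => integrableOn_midpointKernel_mul he (hcont u hu) fun t ht => hC u t hu ht.le
  have hintc : IntegrableOn (fun t : ℝ => midpointKernel (t * e) * φ c) (Ioi 0) :=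
    integrableOn_midpointKernel_mul (C := ‖φ c‖) (p := 0) he continuousOn_const
      fun t ht => by simp
  have hlim : ∀ ψ : ℝ → ℂ, IntegrableOn (fun t : ℝ => midpointKernel (t * e) * ψ t) (Ioi 0) →
      Tendsto (fun T : ℝ => ∫ t in (0 : ℝ)..T, midpointKernel (t * e) * (ψ t - φ c)) atTop
      (𝓝 ((∫ t in Ioi (0 : ℝ), midpointKernel (t * e) * ψ t) -
        ∫ t in Ioi (0 : ℝ), midpointKernel (t * e) * φ c)) := by
    intro ψ hψ
    rw [← integral_sub hψ hintc]
    simp_rw [← mul_sub]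
    refine intervalIntegral_tendsto_integral_Ioi 0 ?_ tendsto_id
    have : IntegrableOn (fun t : ℝ => midpointKernel (t * e) * ψ t - midpointKernel (t * e) * φ c)
      (Ioi 0) := hψ.sub hintc
    simpa only [← mul_sub] using this
  have htop : Tendsto (fun T : ℝ => ∫ u in (0 : ℝ)..1, q (b + u + T * e)) atTop (𝓝 0) := by
    have hbound : ∀ᶠ T : ℝ in atTop, ‖∫ u in (0 : ℝ)..1, q (b + u + T * e)‖ ≤
        (C * (1 + T) ^ p + ‖φ c‖) * (2 * Real.exp (-(2 * Real.pi * e.im * T))) := by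
      filter_upwards [eventually_ge_atTop (1 / (2 * Real.pi * e.im)), eventually_gt_atTop 0]
        with T hT hT0
      have := intervalIntegral.norm_integral_le_of_norm_le_const (a := (0 : ℝ)) (b := 1)
        (f := fun u : ℝ => q (b + u + T * e))
        (C := (C * (1 + T) ^ p + ‖φ c‖) * (2 * Real.exp (-(2 * Real.pi * e.im * T)))) ?_
      · simpa using this
      intro u hu
      rw [uIoc_of_le zero_le_one] at hu
      have him : ((u : ℂ) + T * e).im = T * e.im := by simp
      rw [hq', add_assoc, add_sub_cancel_left, ← add_assoc, norm_mul]
      · have h1 := hC u T hu.1.le hT0.le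
        have h0 : 0 ≤ C * (1 + T) ^ p := (norm_nonneg _).trans h1
        refine mul_le_mul ((norm_sub_le _ _).trans (by gcongr)) ?_ (norm_nonneg _) (by positivity)
        have h2 : 1 ≤ 2 * Real.pi * ((u : ℂ) + T * e).im := by
          rw [him]
          rw [div_le_iff₀ (by positivity)] at hT
          linarith
        have h3 := norm_midpointKernel_le h2
        rw [him] at h3
        rwa [show 2 * Real.pi * e.im * T = 2 * Real.pi * (T * e.im) by ring]
      · intro h
        have h1 := congrArg Complex.im h
        simp [hcdef, he.ne', hT0.ne'] at h1
    refine squeeze_zero_norm' hbound ?_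
    have hd : 0 < 2 * Real.pi * e.im := by positivity
    have h1 : Tendsto (fun T : ℝ => (1 + T) ^ p * Real.exp (-(2 * Real.pi * e.im * (1 + T)))) atTop
        (𝓝 0) := by
      have := (isLittleO_pow_exp_pos_mul_atTop p hd).tendsto_div_nhds_zero.comp
        (tendsto_atTop_add_const_left _ (1 : ℝ) tendsto_id)
      refine this.congr fun T => ?_
      simp [Real.exp_neg, div_eq_mul_inv]
    have h2 : Tendsto (fun T : ℝ => Real.exp (-(2 * Real.pi * e.im * T))) atTop (𝓝 0) :=
      Real.tendsto_exp_neg_atTop_nhds_zero.comp (tendsto_id.const_mul_atTop hd)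
    have h3 := (h1.const_mul (2 * C * Real.exp (2 * Real.pi * e.im))).add
      (h2.const_mul (2 * ‖φ c‖))
    simp only [mul_zero, add_zero] at h3
    refine h3.congr fun T => ?_
    have : Real.exp (-(2 * Real.pi * e.im * T)) =
        Real.exp (2 * Real.pi * e.im) * Real.exp (-(2 * Real.pi * e.im * (1 + T))) := by
      rw [← Real.exp_add]; ring_nf
    rw [this]
    ring
  have hL := ((hlim _ (by simpa using hint 1 zero_le_one)).const_mul e).const_add
    (∫ u in (0 : ℝ)..1, q (b + u))
  have hR := ((hlim _ (by simpa using hint 0 le_rfl)).const_mul e).add htop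
  have hev : (fun T : ℝ => (∫ u in (0 : ℝ)..1, q (b + u)) +
      e * ∫ t in (0 : ℝ)..T, midpointKernel (t * e) * (φ (b + 1 + t * e) - φ c)) =ᶠ[atTop]
      fun T : ℝ => e * (∫ t in (0 : ℝ)..T, midpointKernel (t * e) * (φ (b + t * e) - φ c)) +
        ∫ u in (0 : ℝ)..1, q (b + u + T * e) := by
    filter_upwards [eventually_ge_atTop 0] with T hT
    have := hpar T hT
    have c1 : ∫ t in (0 : ℝ)..T, q (b + 1 + t * e) =
        ∫ t in (0 : ℝ)..T, midpointKernel (t * e) * (φ (b + 1 + t * e) - φ c) :=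
      intervalIntegral.integral_congr fun t ht => hq1 t (by rw [uIcc_of_le hT] at ht; exact ht.1)
    have c0 : ∫ t in (0 : ℝ)..T, q (b + t * e) =
        ∫ t in (0 : ℝ)..T, midpointKernel (t * e) * (φ (b + t * e) - φ c) :=
      intervalIntegral.integral_congr fun t ht => hq0 t (by rw [uIcc_of_le hT] at ht; exact ht.1)
    rw [← c1, ← c0]
    exact this
  have hfin := tendsto_nhds_unique (hL.congr' hev) hR
  rw [intervalIntegral.integral_congr_ae hae] at hfin
  refine ⟨hbi.congr_ae ((ae_restrict_iff' measurableSet_uIoc).mpr hae), ?_⟩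
  linear_combination hfin

/-- The sum of the values of `φ` at the points `b + te` and `b + t conj e` of two conjugate rays,
weighted by the kernel and by its conjugate, and by the directions of the rays. -/
noncomputable def rayIntegrand (e : ℂ) (φ : ℂ → ℂ) (b t : ℝ) : ℂ :=
  e * midpointKernel (t * e) * φ (b + t * e) +
    conj (e * midpointKernel (t * e)) * φ (b + t * conj e)

/-- The correction term of the midpoint Abel–Plana formula: the integral of `φ` against the kernel
along the ray from `b` in the direction `e`, plus the integral against the conjugate kernel along
the conjugate ray.  For `e = I` these are the two halves of a vertical line. -/
noncomputable def rayIntegral (e : ℂ) (φ : ℂ → ℂ) (b : ℝ) : ℂ :=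
  ∫ t in Ioi (0 : ℝ), rayIntegrand e φ b t

theorem midpointKernel_add_conj {u : ℝ} (hu : u ∈ Ioc (0 : ℝ) 1) (hu' : u ≠ 1 / 2) :
    midpointKernel u + conj (midpointKernel u) = 1 := by
  have hne : Complex.exp (-(2 * Real.pi * Complex.I * u)) + 1 ≠ 0 := by
    intro h
    obtain ⟨n, hn⟩ := exp_eq_neg_one_of_midpoint (eq_neg_of_add_eq_zero_left h)
    have h2 : u = 1 / 2 + n := by simpa using congrArg Complex.re hn
    have h5 : (n : ℝ) < 1 := by linarith [hu.2]
    have h6 : (-1 : ℝ) < n := by linarith [hu.1]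
    have h7 : n < 1 := by exact_mod_cast h5
    have h8 : -1 < n := by exact_mod_cast h6
    obtain rfl : n = 0 := by omega
    exact hu' (by simpa using h2)
  have hconj : conj (Complex.exp (-(2 * Real.pi * Complex.I * u))) =
      (Complex.exp (-(2 * Real.pi * Complex.I * u)))⁻¹ := by
    rw [← Complex.exp_conj, ← Complex.exp_neg]
    simp [map_ofNat]
  unfold midpointKernel
  rw [map_inv₀, map_add, hconj, map_one]
  set E := Complex.exp (-(2 * Real.pi * Complex.I * u))
  have hE : E ≠ 0 := Complex.exp_ne_zero _
  have h3 : E⁻¹ + 1 = (E + 1) / E := by field_simp; ring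
  rw [h3]
  field_simp
  ring

theorem differentiableOn_conj_comp_conj {φ : ℂ → ℂ} (hφ : DifferentiableOn ℂ φ {z | 0 < z.re}) :
    DifferentiableOn ℂ (conj ∘ φ ∘ conj) {z | 0 < z.re} := by
  intro z hz
  have hz' : conj z ∈ {z : ℂ | 0 < z.re} := by
    have : 0 < z.re := hz
    simpa using this
  have h1 : DifferentiableAt ℂ φ (conj z) :=
    hφ.differentiableAt ((isOpen_lt continuous_const Complex.continuous_re).mem_nhds hz')
  have h2 := h1.conj_conj
  rw [Complex.conj_conj] at h2
  exact h2.differentiableWithinAt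

theorem integrableOn_midpointKernel_mul_ray {φ : ℂ → ℂ} {b : ℝ} {e : ℂ} {C : ℝ} {p : ℕ}
    (hb : 0 < b) (he0 : 0 ≤ e.re) (he : 0 < e.im) (hφ : DifferentiableOn ℂ φ {z | 0 < z.re})
    (hC : ∀ t : ℝ, 0 ≤ t → ‖φ (b + t * e)‖ ≤ C * (1 + t) ^ p) :
    IntegrableOn (fun t : ℝ => e * midpointKernel (t * e) * φ (b + t * e)) (Ioi 0) := by
  simp_rw [mul_assoc]
  refine (integrableOn_midpointKernel_mul he ?_ fun t ht => hC t ht.le).const_mul e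
  exact hφ.continuousOn.comp (by fun_prop) fun t ht => re_pos_of_ray hb he0 (le_of_lt ht)

theorem integrableOn_conj_midpointKernel_mul_ray {φ : ℂ → ℂ} {b : ℝ} {e : ℂ} {C : ℝ} {p : ℕ}
    (hb : 0 < b) (he0 : 0 ≤ e.re) (he : 0 < e.im) (hφ : DifferentiableOn ℂ φ {z | 0 < z.re})
    (hC : ∀ t : ℝ, 0 ≤ t → ‖φ (b + t * conj e)‖ ≤ C * (1 + t) ^ p) :
    IntegrableOn (fun t : ℝ => conj (e * midpointKernel (t * e)) * φ (b + t * conj e)) (Ioi 0) := by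
  have h := integrableOn_midpointKernel_mul_ray (C := C) (p := p) hb he0 he
    (differentiableOn_conj_comp_conj hφ) (fun t ht => by simpa using hC t ht)
  have h2 := Complex.conjCLE.toContinuousLinearMap.integrable_comp h
  refine h2.congr (ae_of_all _ fun t => ?_)
  simp

theorem integrableOn_rayIntegrand {φ : ℂ → ℂ} {b : ℝ} {e : ℂ} {C : ℝ} {p : ℕ}
    (hb : 0 < b) (he0 : 0 ≤ e.re) (he : 0 < e.im) (hφ : DifferentiableOn ℂ φ {z | 0 < z.re})
    (hC : ∀ t : ℝ, 0 ≤ t → ‖φ (b + t * e)‖ ≤ C * (1 + t) ^ p)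
    (hC' : ∀ t : ℝ, 0 ≤ t → ‖φ (b + t * conj e)‖ ≤ C * (1 + t) ^ p) :
    IntegrableOn (rayIntegrand e φ b) (Ioi 0) :=
  (integrableOn_midpointKernel_mul_ray hb he0 he hφ hC).add
    (integrableOn_conj_midpointKernel_mul_ray hb he0 he hφ hC')

theorem norm_rayIntegrand_le {φ : ℂ → ℂ} {b t : ℝ} {e : ℂ} {B K : ℝ}
    (hK : ‖e * midpointKernel (t * e)‖ ≤ K) (hB : ‖φ (b + t * e)‖ ≤ B)
    (hB' : ‖φ (b + t * conj e)‖ ≤ B) : ‖rayIntegrand e φ b t‖ ≤ 2 * (K * B) := by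
  have hK0 := (norm_nonneg _).trans hK
  refine (norm_add_le _ _).trans ?_
  rw [norm_mul _ (φ _), norm_mul _ (φ _), RCLike.norm_conj, two_mul]
  gcongr

theorem rayIntegral_eq_add {φ : ℂ → ℂ} {b : ℝ} {e : ℂ} {C : ℝ} {p : ℕ}
    (hb : 0 < b) (he0 : 0 ≤ e.re) (he : 0 < e.im) (hφ : DifferentiableOn ℂ φ {z | 0 < z.re})
    (hC : ∀ t : ℝ, 0 ≤ t → ‖φ (b + t * e)‖ ≤ C * (1 + t) ^ p)
    (hC' : ∀ t : ℝ, 0 ≤ t → ‖φ (b + t * conj e)‖ ≤ C * (1 + t) ^ p) :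
    rayIntegral e φ b = e * (∫ t in Ioi (0 : ℝ), midpointKernel (t * e) * φ (b + t * e)) +
      conj (e * ∫ t in Ioi (0 : ℝ), midpointKernel (t * e) * (conj ∘ φ ∘ conj) (b + t * e)) := by
  unfold rayIntegral rayIntegrand
  rw [integral_add (integrableOn_midpointKernel_mul_ray hb he0 he hφ hC)
    (integrableOn_conj_midpointKernel_mul_ray hb he0 he hφ hC')]
  congr 1
  · rw [← integral_const_mul]; simp_rw [mul_assoc]
  · rw [← integral_const_mul, ← integral_conj]
    simp [mul_assoc]

/-- The midpoint Abel–Plana formula over a unit step.  The singularities of the kernel at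
`b + 1/2` play no role, because the upper and lower halves of Cauchy's theorem are applied to
`φ - φ(b + 1/2)`, and the kernel and its conjugate add up to `1` on the real line. -/
theorem abelPlana_step {φ : ℂ → ℂ} {b : ℝ} {e : ℂ} {C : ℝ} {p : ℕ} (hb : 0 < b)
    (he0 : 0 ≤ e.re) (he : 0 < e.im) (hφ : DifferentiableOn ℂ φ {z | 0 < z.re})
    (hC : ∀ u t : ℝ, 0 ≤ u → 0 ≤ t → ‖φ (b + u + t * e)‖ ≤ C * (1 + t) ^ p)
    (hC' : ∀ u t : ℝ, 0 ≤ u → 0 ≤ t → ‖φ (b + u + t * conj e)‖ ≤ C * (1 + t) ^ p) :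
    φ (b + 1 / 2) = (∫ u in (0 : ℝ)..1, φ (b + u)) + rayIntegral e φ (b + 1 : ℝ) -
      rayIntegral e φ b := by
  set φ' : ℂ → ℂ := conj ∘ φ ∘ conj with hφ'def
  have hφ' : DifferentiableOn ℂ φ' {z | 0 < z.re} := differentiableOn_conj_comp_conj hφ
  obtain ⟨i1, e1⟩ := abelPlana_step_upper hb he0 he hφ hC
  obtain ⟨i2, e2⟩ := abelPlana_step_upper hb he0 he hφ'
    (fun u t hu ht => by simpa [hφ'def] using hC' u t hu ht)
  have i2' : IntervalIntegrable
      (fun u : ℝ => (φ (b + u) - φ (b + 1 / 2)) * conj (midpointKernel u)) volume 0 1 := by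
    rw [intervalIntegrable_iff] at i2 ⊢
    refine (Complex.conjCLE.toContinuousLinearMap.integrable_comp i2).congr
      (ae_of_all _ fun u => ?_)
    simp [hφ'def, map_ofNat]
  have e2' := congrArg conj e2
  rw [map_add, intervalIntegral.integral_of_le zero_le_one, ← integral_conj,
    ← intervalIntegral.integral_of_le zero_le_one] at e2'
  have e3 : (fun u : ℝ => conj ((φ' (b + u) - φ' (b + 1 / 2)) * midpointKernel u)) =
      fun u : ℝ => (φ (b + u) - φ (b + 1 / 2)) * conj (midpointKernel u) := by
    funext u; simp [hφ'def, map_ofNat]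
  rw [e3] at e2'
  have hcont : ContinuousOn (fun u : ℝ => φ (b + u)) (uIcc 0 1) := by
    refine hφ.continuousOn.comp (by fun_prop) fun u hu => ?_
    rw [uIcc_of_le zero_le_one] at hu
    have := hu.1
    simp
    positivity
  have hsum : (∫ u in (0 : ℝ)..1, (φ (b + u) - φ (b + 1 / 2)) * midpointKernel u) +
      (∫ u in (0 : ℝ)..1, (φ (b + u) - φ (b + 1 / 2)) * conj (midpointKernel u)) =
      (∫ u in (0 : ℝ)..1, φ (b + u)) - φ (b + 1 / 2) := by
    rw [← intervalIntegral.integral_add i1 i2']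
    have : (∫ u in (0 : ℝ)..1, φ (b + u)) - φ (b + 1 / 2) =
        ∫ u in (0 : ℝ)..1, (φ (b + u) - φ (b + 1 / 2)) := by
      rw [intervalIntegral.integral_sub hcont.intervalIntegrable intervalIntegrable_const]
      simp
    rw [this]
    refine intervalIntegral.integral_congr_ae ?_
    filter_upwards [Measure.ae_ne volume (1 / 2)] with u hu hu'
    rw [uIoc_of_le zero_le_one] at hu'
    rw [← mul_add, midpointKernel_add_conj hu' hu, mul_one]
  have r0 := rayIntegral_eq_add hb he0 he hφ (fun t ht => by simpa using hC 0 t le_rfl ht)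
    (fun t ht => by simpa using hC' 0 t le_rfl ht)
  have r1 := rayIntegral_eq_add (b := b + 1) (by positivity) he0 he hφ
    (fun t ht => by simpa using hC 1 t zero_le_one ht)
    (fun t ht => by simpa using hC' 1 t zero_le_one ht)
  rw [← hφ'def] at r0 r1
  rw [r0, r1]
  push_cast
  linear_combination hsum - e1 - e2'

/-- The Abel–Plana formula for a finite sum, by telescoping. -/
theorem abelPlana_sum {φ : ℂ → ℂ} {b : ℝ} {e : ℂ} {C : ℝ} {p : ℕ} (hb : 0 < b)
    (he0 : 0 ≤ e.re) (he : 0 < e.im) (hφ : DifferentiableOn ℂ φ {z | 0 < z.re})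
    (hC : ∀ u t : ℝ, 0 ≤ u → 0 ≤ t → ‖φ (b + u + t * e)‖ ≤ C * (1 + t) ^ p)
    (hC' : ∀ u t : ℝ, 0 ≤ u → 0 ≤ t → ‖φ (b + u + t * conj e)‖ ≤ C * (1 + t) ^ p) (n : ℕ) :
    ∑ k ∈ Finset.range n, φ (b + 1 / 2 + k) =
      (∫ u in b..(b + n), φ u) + rayIntegral e φ (b + n : ℝ) - rayIntegral e φ b := by
  have hcont : ContinuousOn (fun u : ℝ => φ u) (Ioi 0) :=
    hφ.continuousOn.comp (by fun_prop) fun u hu => by simpa using hu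
  induction n with
  | zero => simp
  | succ n ih =>
    have hbn : 0 < b + n := by positivity
    have hs := abelPlana_step (b := b + n) (C := C) (p := p) hbn he0 he hφ
      (fun u t hu ht => by
        have := hC (n + u) t (by positivity) ht
        push_cast at this ⊢
        rwa [add_assoc (b : ℂ)])
      (fun u t hu ht => by
        have := hC' (n + u) t (by positivity) ht
        push_cast at this ⊢
        rwa [add_assoc (b : ℂ)])
    have hsh : (∫ u in (0 : ℝ)..1, φ ((b + n : ℝ) + u)) = ∫ u in (b + n)..(b + n + 1), φ u := by
      have := intervalIntegral.integral_comp_add_left (a := (0 : ℝ)) (b := 1)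
        (fun u : ℝ => φ u) (b + n)
      simpa using this
    have hii : ∀ x y : ℝ, 0 < x → x ≤ y → IntervalIntegrable (fun u : ℝ => φ u) volume x y := by
      intro x y hx hxy
      refine (hcont.mono fun u hu => ?_).intervalIntegrable
      rw [uIcc_of_le hxy] at hu
      exact hx.trans_le hu.1
    have hadd := intervalIntegral.integral_add_adjacent_intervals
      (hii b (b + n) hb (by simp)) (hii (b + n) (b + n + 1) hbn (by simp))
    rw [Finset.sum_range_succ, ih]
    rw [hsh] at hs
    push_cast at hs hadd ⊢
    rw [← add_assoc, ← hadd, show (b : ℂ) + 1 / 2 + n = b + n + 1 / 2 by ring, hs]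
    ring

/-- The Abel–Plana formula in the form of a limit.  The function `w` controls `φ` in terms of the
real part, uniformly up to a power of the distance travelled along the rays. -/
theorem abelPlana_tendsto {φ : ℂ → ℂ} {b : ℝ} {e : ℂ} {C : ℝ} {p : ℕ} {w : ℝ → ℝ} (hb : 0 < b)
    (he0 : 0 ≤ e.re) (he : 0 < e.im) (hφ : DifferentiableOn ℂ φ {z | 0 < z.re})
    (hwC : ∀ y, b ≤ y → w y ≤ C) (hw0 : Tendsto w atTop (𝓝 0))
    (hw : ∀ u t : ℝ, 0 ≤ u → 0 ≤ t →
      ‖φ (b + u + t * e)‖ ≤ w (b + u + t * e.re) * (1 + t) ^ p)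
    (hw' : ∀ u t : ℝ, 0 ≤ u → 0 ≤ t →
      ‖φ (b + u + t * conj e)‖ ≤ w (b + u + t * e.re) * (1 + t) ^ p) :
    Tendsto (fun n : ℕ => (∑ k ∈ Finset.range n, φ (b + 1 / 2 + k)) - ∫ u in b..(b + n), φ u)
      atTop (𝓝 (-rayIntegral e φ b)) := by
  have hle : ∀ u t : ℝ, 0 ≤ u → 0 ≤ t → w (b + u + t * e.re) * (1 + t) ^ p ≤ C * (1 + t) ^ p := by
    intro u t hu ht
    refine mul_le_mul_of_nonneg_right (hwC _ ?_) (by positivity)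
    have : 0 ≤ t * e.re := by positivity
    linarith
  have hC : ∀ u t : ℝ, 0 ≤ u → 0 ≤ t → ‖φ (b + u + t * e)‖ ≤ C * (1 + t) ^ p :=
    fun u t hu ht => (hw u t hu ht).trans (hle u t hu ht)
  have hC' : ∀ u t : ℝ, 0 ≤ u → 0 ≤ t → ‖φ (b + u + t * conj e)‖ ≤ C * (1 + t) ^ p :=
    fun u t hu ht => (hw' u t hu ht).trans (hle u t hu ht)
  have hR : Tendsto (fun n : ℕ => rayIntegral e φ (b + n : ℝ)) atTop (𝓝 0) := by
    obtain ⟨M, hM0, hM⟩ := exists_norm_midpointKernel_ray_le he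
    have hk : ∀ t ∈ Ioi (0 : ℝ), ‖e * midpointKernel (t * e)‖ ≤
        ‖e‖ * (M * Real.exp (-(2 * Real.pi * e.im * t))) := fun t ht => by
      rw [norm_mul]
      gcongr
      exact hM t (le_of_lt ht)
    have h0 : (0 : ℂ) = ∫ t in Ioi (0 : ℝ), (0 : ℂ) := by simp
    unfold rayIntegral
    rw [h0]
    refine tendsto_integral_of_dominated_convergence
      (fun t => (2 * ‖e‖ * M * C) * ((1 + t) ^ p * Real.exp (-(2 * Real.pi * e.im * t))))
      ?_ ?_ ?_ ?_
    · intro n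
      have hbn : 0 < b + n := by positivity
      exact (integrableOn_rayIntegrand hbn he0 he hφ
        (fun t ht => by simpa using hC n t (by positivity) ht)
        (fun t ht => by simpa using hC' n t (by positivity) ht)).aestronglyMeasurable
    · exact (integrableOn_one_add_pow_mul_exp_neg p (by positivity)).const_mul _
    · intro n
      refine (ae_restrict_iff' measurableSet_Ioi).mpr (ae_of_all _ fun t ht => ?_)
      refine (norm_rayIntegrand_le (hk t ht)
        (by simpa using hC n t (by positivity) (le_of_lt ht))
        (by simpa using hC' n t (by positivity) (le_of_lt ht))).trans_eq ?_
      ring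
    · refine (ae_restrict_iff' measurableSet_Ioi).mpr (ae_of_all _ fun t ht => ?_)
      have ht0 : 0 ≤ t := le_of_lt ht
      have hlim : Tendsto (fun n : ℕ => w (b + n + t * e.re) * (1 + t) ^ p) atTop (𝓝 0) := by
        have h1 : Tendsto (fun n : ℕ => b + n + t * e.re) atTop atTop :=
          tendsto_atTop_add_const_right _ _
            (tendsto_atTop_add_const_left _ _ tendsto_natCast_atTop_atTop)
        simpa using (hw0.comp h1).mul_const ((1 + t) ^ p)
      have g1 : Tendsto (fun n : ℕ => φ ((b + n : ℝ) + t * e)) atTop (𝓝 0) :=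
        squeeze_zero_norm (fun n => by simpa using hw n t (by positivity) ht0) hlim
      have g2 : Tendsto (fun n : ℕ => φ ((b + n : ℝ) + t * conj e)) atTop (𝓝 0) :=
        squeeze_zero_norm (fun n => by simpa using hw' n t (by positivity) ht0) hlim
      simpa [rayIntegrand] using (g1.const_mul (e * midpointKernel (t * e))).add
        (g2.const_mul (conj (e * midpointKernel (t * e))))
  have hfin := hR.sub_const (rayIntegral e φ b)
  rw [zero_sub] at hfin
  refine hfin.congr fun n => ?_
  rw [abelPlana_sum hb he0 he hφ hC hC' n]
  ring

/-- The Abel–Plana formula for an infinite series. -/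
theorem abelPlana_hasSum {φ : ℂ → ℂ} {b : ℝ} {e : ℂ} {C : ℝ} {p : ℕ} {w : ℝ → ℝ} (hb : 0 < b)
    (he0 : 0 ≤ e.re) (he : 0 < e.im) (hφ : DifferentiableOn ℂ φ {z | 0 < z.re})
    (hwC : ∀ y, b ≤ y → w y ≤ C) (hw0 : Tendsto w atTop (𝓝 0))
    (hw : ∀ u t : ℝ, 0 ≤ u → 0 ≤ t →
      ‖φ (b + u + t * e)‖ ≤ w (b + u + t * e.re) * (1 + t) ^ p)
    (hw' : ∀ u t : ℝ, 0 ≤ u → 0 ≤ t →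
      ‖φ (b + u + t * conj e)‖ ≤ w (b + u + t * e.re) * (1 + t) ^ p)
    {S : ℂ} (hS : HasSum (fun k : ℕ => φ (b + 1 / 2 + k)) S)
    (hi : IntegrableOn (fun u : ℝ => φ u) (Ioi b)) :
    S = (∫ u in Ioi b, φ u) - rayIntegral e φ b := by
  have h1 := abelPlana_tendsto hb he0 he hφ hwC hw0 hw hw'
  have h2 : Tendsto (fun n : ℕ => ∫ u in b..(b + n), φ u) atTop (𝓝 (∫ u in Ioi b, φ u)) :=
    intervalIntegral_tendsto_integral_Ioi b hi
      (tendsto_atTop_add_const_left _ _ tendsto_natCast_atTop_atTop)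
  have h3 := tendsto_nhds_unique h1 (hS.tendsto_sum_nat.sub h2)
  linear_combination -h3

/-! ### Complex powers on the rays -/

theorem norm_log_le (z : ℂ) : ‖Complex.log z‖ ≤ |Real.log ‖z‖| + Real.pi := by
  refine (Complex.norm_le_abs_re_add_abs_im _).trans ?_
  rw [Complex.log_re, Complex.log_im]
  gcongr
  exact Complex.abs_arg_le_pi z

theorem norm_cpow_le_exp {z : ℂ} (hz : z ≠ 0) (s : ℂ) :
    ‖z ^ s‖ ≤ Real.exp (‖Complex.log z‖) ^ ‖s‖ := by
  rw [Complex.cpow_def_of_ne_zero hz, ← Real.exp_mul, ← norm_mul]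
  exact Complex.norm_exp_le_exp_norm _

theorem exp_norm_log_le {b t : ℝ} (hb : 0 < b) (ht : 0 ≤ t) {z : ℂ} (h1 : b ≤ z.re)
    (h2 : ‖z‖ ≤ b + t) :
    Real.exp ‖Complex.log z‖ ≤ (1 + b + b⁻¹) * Real.exp Real.pi * (1 + t) := by
  have hbz : b ≤ ‖z‖ := h1.trans (Complex.re_le_norm z)
  have hz : 0 < ‖z‖ := hb.trans_le hbz
  have h3 : Real.exp |Real.log ‖z‖| ≤ (1 + b + b⁻¹) * (1 + t) := by
    have hi : 0 < b⁻¹ := inv_pos.mpr hb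
    rcases abs_cases (Real.log ‖z‖) with ⟨h, -⟩ | ⟨h, -⟩
    · rw [h, Real.exp_log hz]
      nlinarith [mul_nonneg hb.le ht, mul_nonneg hi.le ht]
    · rw [h, Real.exp_neg, Real.exp_log hz]
      have := inv_anti₀ hb hbz
      nlinarith [mul_nonneg hb.le ht, mul_nonneg hi.le ht]
  calc _ ≤ Real.exp (|Real.log ‖z‖| + Real.pi) := Real.exp_le_exp.mpr (norm_log_le z)
    _ = Real.exp |Real.log ‖z‖| * Real.exp Real.pi := Real.exp_add _ _
    _ ≤ (1 + b + b⁻¹) * (1 + t) * Real.exp Real.pi := by gcongr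
    _ = _ := by ring

theorem ray_bounds {b t : ℝ} {e : ℂ} (ht : 0 ≤ t) (hb : 0 < b) (he0 : 0 ≤ e.re)
    (he1 : ‖e‖ ≤ 1) : b ≤ ((b : ℂ) + t * e).re ∧ ‖(b : ℂ) + t * e‖ ≤ b + t := by
  constructor
  · simp
    positivity
  · refine (norm_add_le _ _).trans ?_
    rw [norm_mul, Complex.norm_real, Complex.norm_real, Real.norm_of_nonneg hb.le,
      Real.norm_of_nonneg ht]
    nlinarith [norm_nonneg e]

theorem exp_norm_log_ray_le {b t : ℝ} {e : ℂ} (ht : 0 ≤ t) (hb : 0 < b) (he0 : 0 ≤ e.re)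
    (he1 : ‖e‖ ≤ 1) :
    Real.exp ‖Complex.log (b + t * e)‖ ≤ (1 + b + b⁻¹) * Real.exp Real.pi * (1 + t) :=
  exp_norm_log_le hb ht (ray_bounds ht hb he0 he1).1 (ray_bounds ht hb he0 he1).2

theorem norm_cpow_ray_le {b t : ℝ} {e : ℂ} (ht : 0 ≤ t) (hb : 0 < b) (he0 : 0 ≤ e.re)
    (he1 : ‖e‖ ≤ 1) (s : ℂ) :
    ‖((b : ℂ) + t * e) ^ s‖ ≤
      ((1 + b + b⁻¹) * Real.exp Real.pi) ^ ⌈‖s‖⌉₊ * (1 + t) ^ ⌈‖s‖⌉₊ := by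
  have hz : (b : ℂ) + t * e ≠ 0 := by
    intro h
    have := (ray_bounds ht hb he0 he1).1
    rw [h] at this
    simp at this
    linarith
  refine (norm_cpow_le_exp hz s).trans ?_
  calc _ ≤ Real.exp ‖Complex.log (b + t * e)‖ ^ (⌈‖s‖⌉₊ : ℝ) :=
        Real.rpow_le_rpow_of_exponent_le (Real.one_le_exp (norm_nonneg _)) (Nat.le_ceil _)
    _ = Real.exp ‖Complex.log (b + t * e)‖ ^ ⌈‖s‖⌉₊ := Real.rpow_natCast _ _
    _ ≤ ((1 + b + b⁻¹) * Real.exp Real.pi * (1 + t)) ^ ⌈‖s‖⌉₊ := by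
        gcongr
        exact exp_norm_log_ray_le ht hb he0 he1
    _ = _ := mul_pow _ _ _

theorem differentiableOn_cpow_const (s : ℂ) :
    DifferentiableOn ℂ (fun z : ℂ => z ^ s) {z | 0 < z.re} := fun _ hz =>
  (differentiableAt_id.cpow_const (Or.inl hz)).differentiableWithinAt

theorem differentiableOn_log : DifferentiableOn ℂ Complex.log {z | 0 < z.re} := fun _ hz =>
  (Complex.differentiableAt_log (Or.inl hz)).differentiableWithinAt

theorem norm_cpow_mul_log_ray_le {b t : ℝ} {e s : ℂ} {N : ℕ} (ht : 0 ≤ t) (hb : 0 < b)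
    (he0 : 0 ≤ e.re) (he1 : ‖e‖ ≤ 1) (hs : ‖s‖ ≤ N) :
    ‖((b : ℂ) + t * e) ^ s * Complex.log (b + t * e)‖ ≤
      ((1 + b + b⁻¹) * Real.exp Real.pi) ^ (N + 1) * (1 + t) ^ (N + 1) := by
  have hz : (b : ℂ) + t * e ≠ 0 := by
    intro h
    have := (ray_bounds ht hb he0 he1).1
    rw [h] at this
    simp at this
    linarith
  have hlog := exp_norm_log_ray_le ht hb he0 he1
  set Λ := Complex.log (b + t * e)
  rw [norm_mul]
  calc _ ≤ Real.exp ‖Λ‖ ^ N * Real.exp ‖Λ‖ := by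
        gcongr
        · refine (norm_cpow_le_exp hz s).trans ?_
          rw [← Real.rpow_natCast]
          exact Real.rpow_le_rpow_of_exponent_le (Real.one_le_exp (norm_nonneg _)) hs
        · linarith [Real.add_one_le_exp ‖Λ‖]
    _ = Real.exp ‖Λ‖ ^ (N + 1) := (pow_succ _ _).symm
    _ ≤ ((1 + b + b⁻¹) * Real.exp Real.pi * (1 + t)) ^ (N + 1) := by gcongr
    _ = _ := mul_pow _ _ _

/-- The correction term for a power `z ^ s` is an entire function of the exponent. -/
theorem differentiable_rayIntegral_cpow {b : ℝ} {e : ℂ} (hb : 0 < b) (he0 : 0 ≤ e.re)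
    (he : 0 < e.im) (he1 : ‖e‖ ≤ 1) :
    Differentiable ℂ fun s : ℂ => rayIntegral e (fun z => z ^ s) b := by
  intro s₀
  obtain ⟨M, hM0, hM⟩ := exists_norm_midpointKernel_ray_le he
  have hc0 : 0 ≤ (conj e).re := by simpa using he0
  have hc1 : ‖conj e‖ ≤ 1 := by simpa using he1
  set A := (1 + b + b⁻¹) * Real.exp Real.pi
  set R := ⌈‖s₀‖ + 1⌉₊ + 1 with hR
  have hA : 0 < A := by positivity
  have hball' : ∀ s ∈ Metric.ball s₀ 1, ‖s‖ ≤ (⌈‖s₀‖ + 1⌉₊ : ℝ) := by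
    intro s hs
    have := norm_le_norm_add_norm_sub' s s₀
    rw [Metric.mem_ball, dist_eq_norm] at hs
    exact le_trans (by linarith) (Nat.le_ceil _)
  have hder : ∀ e' : ℂ, 0 ≤ e'.re → ‖e'‖ ≤ 1 → ∀ t : ℝ, 0 ≤ t → ∀ s ∈ Metric.ball s₀ 1,
      ‖((b : ℂ) + t * e') ^ s * Complex.log (b + t * e')‖ ≤ A ^ R * (1 + t) ^ R :=
    fun e' h0 h1 t ht s hs => norm_cpow_mul_log_ray_le ht hb h0 h1 (hball' s hs)
  have hdiff : DifferentiableOn ℂ (fun z : ℂ => z ^ s₀ * Complex.log z) {z | 0 < z.re} :=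
    (differentiableOn_cpow_const s₀).mul differentiableOn_log
  have hball : s₀ ∈ Metric.ball s₀ 1 := Metric.mem_ball_self one_pos
  have hint : ∀ s : ℂ, IntegrableOn (rayIntegrand e (fun z => z ^ s) b) (Ioi 0) := fun s =>
    integrableOn_rayIntegrand hb he0 he (differentiableOn_cpow_const s)
      (fun t ht => norm_cpow_ray_le ht hb he0 he1 s) (fun t ht => norm_cpow_ray_le ht hb hc0 hc1 s)
  refine (hasDerivAt_integral_of_dominated_loc_of_deriv_le (μ := volume.restrict (Ioi 0))
    (F := fun s : ℂ => rayIntegrand e (fun z => z ^ s) b)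
    (F' := fun s : ℂ => rayIntegrand e (fun z => z ^ s * Complex.log z) b)
    (bound := fun t => 2 * M * A ^ R * ((1 + t) ^ R * Real.exp (-(2 * Real.pi * e.im * t))))
    (x₀ := s₀) (s := Metric.ball s₀ 1) (Metric.ball_mem_nhds _ one_pos)
    (Eventually.of_forall fun s => (hint s).aestronglyMeasurable) (hint s₀) ?_ ?_ ?_
    ?_).2.differentiableAt
  · exact (integrableOn_rayIntegrand hb he0 he hdiff (fun t ht => hder e he0 he1 t ht s₀ hball)
      (fun t ht => hder _ hc0 hc1 t ht s₀ hball)).aestronglyMeasurable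
  · refine (ae_restrict_iff' measurableSet_Ioi).mpr (ae_of_all _ fun t ht s hs => ?_)
    have ht0 : 0 ≤ t := le_of_lt ht
    have hk : ‖e * midpointKernel (t * e)‖ ≤ M * Real.exp (-(2 * Real.pi * e.im * t)) := by
      rw [norm_mul]
      calc _ ≤ 1 * (M * Real.exp (-(2 * Real.pi * e.im * t))) := by
            gcongr
            exact hM t ht0
        _ = _ := one_mul _
    refine (norm_rayIntegrand_le hk (hder e he0 he1 t ht0 s hs)
      (hder _ hc0 hc1 t ht0 s hs)).trans_eq ?_
    ring
  · exact (integrableOn_one_add_pow_mul_exp_neg R (by positivity)).const_mul _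
  · refine (ae_restrict_iff' measurableSet_Ioi).mpr (ae_of_all _ fun t ht s hs => ?_)
    have hne : ∀ e' : ℂ, 0 ≤ e'.re → (b : ℂ) + t * e' ≠ 0 := fun e' h0 h => by
      have := re_pos_of_ray hb h0 (le_of_lt ht)
      rw [h] at this
      simp at this
    have hd : ∀ z : ℂ, z ≠ 0 → HasDerivAt (fun s : ℂ => z ^ s) (z ^ s * Complex.log z) s :=
      fun z hz => by simpa using (hasDerivAt_id s).const_cpow (Or.inl hz)
    exact ((hd _ (hne e he0)).const_mul _).add ((hd _ (hne _ hc0)).const_mul _)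

/-! ### Hermite's formula for the Hurwitz zeta function -/

theorem norm_cpow_le_rpow_re {z s : ℂ} (hz : 0 < z.re) (hs : s.re ≤ 0) :
    ‖z ^ s‖ ≤ Real.exp (Real.pi * |s.im|) * z.re ^ s.re := by
  have hz0 : z ≠ 0 := by rintro rfl; simp at hz
  rw [Complex.norm_cpow_of_ne_zero hz0, div_eq_mul_inv, ← Real.exp_neg, mul_comm]
  have h1 : -(z.arg * s.im) ≤ Real.pi * |s.im| := by
    calc _ ≤ |z.arg * s.im| := neg_le_abs _
      _ = |z.arg| * |s.im| := abs_mul _ _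
      _ ≤ _ := by gcongr; exact Complex.abs_arg_le_pi z
  have h2 : ‖z‖ ^ s.re ≤ z.re ^ s.re :=
    Real.rpow_le_rpow_of_nonpos hz (Complex.re_le_norm z) hs
  gcongr

/-- The bounds required by the Abel–Plana formula, for the powers with negative exponent. -/
theorem norm_cpow_wedge_le {b u t : ℝ} {e s : ℂ} (hb : 0 < b) (he0 : 0 ≤ e.re) (hs : s.re < 0)
    (hu : 0 ≤ u) (ht : 0 ≤ t) :
    ‖((b : ℂ) + u + t * e) ^ s‖ ≤
      Real.exp (Real.pi * |s.im|) * (b + u + t * e.re) ^ s.re * (1 + t) ^ 0 := by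
  have h : ((b : ℂ) + u + t * e).re = b + u + t * e.re := by simp
  have := norm_cpow_le_rpow_re (z := (b : ℂ) + u + t * e) (s := s) (by rw [h]; positivity) hs.le
  rw [pow_zero, mul_one]
  rwa [h] at this

theorem tendsto_const_mul_rpow_neg {C σ : ℝ} (hσ : σ < 0) :
    Tendsto (fun y : ℝ => C * y ^ σ) atTop (𝓝 0) := by
  have := tendsto_rpow_neg_atTop (neg_pos.mpr hσ)
  simpa using this.const_mul C

/-- Hermite's formula for the Hurwitz zeta function, with the midpoint kernel and oblique rays. -/
theorem hurwitzZetaPos_eq {a : ℝ} {e : ℂ} (ha : 0 < a) (he0 : 0 ≤ e.re) (he : 0 < e.im)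
    (he1 : ‖e‖ ≤ 1) {s : ℂ} (hs : s ≠ 1) :
    hurwitzZetaPos s a = (a : ℂ) ^ (-s) + ((a + 1 / 2 : ℝ) : ℂ) ^ (1 - s) / (s - 1) -
      rayIntegral e (fun z => z ^ (-s)) (a + 1 / 2) := by
  set b := a + 1 / 2 with hbdef
  have hb : 0 < b := by positivity
  have ha' : (a : ℂ) ≠ 0 := by exact_mod_cast ha.ne'
  have hb' : (b : ℂ) ≠ 0 := by exact_mod_cast hb.ne'
  have hc0 : 0 ≤ (conj e).re := by simpa using he0
  have hhalf : ∀ s : ℂ, 1 < s.re → hurwitzZetaPos s a =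
      (a : ℂ) ^ (-s) + (b : ℂ) ^ (1 - s) / (s - 1) - rayIntegral e (fun z => z ^ (-s)) b := by
    intro s hs
    have hs0 : (-s).re < 0 := by simp; linarith
    have hs1 : (-s).re < -1 := by simp; linarith
    have h1 := hasSum_hurwitzZetaPos ha hs
    rw [← hasSum_nat_add_iff' 1] at h1
    have h2 : HasSum (fun k : ℕ => ((b : ℂ) + 1 / 2 + k) ^ (-s))
        (hurwitzZetaPos s a - (a : ℂ) ^ (-s)) := by
      have e1 : (fun k : ℕ => 1 / (((k + 1 : ℕ) : ℝ) + a : ℝ) ^ s : ℕ → ℂ) =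
          fun k : ℕ => ((b : ℂ) + 1 / 2 + k) ^ (-s) := by
        funext k
        rw [Complex.cpow_neg, one_div, hbdef]
        push_cast
        ring_nf
      have e2 : ∑ i ∈ Finset.range 1, 1 / (((i : ℝ) + a : ℝ) : ℂ) ^ s = (a : ℂ) ^ (-s) := by
        simp [Complex.cpow_neg]
      rwa [e1, e2] at h1
    have h3 := abelPlana_hasSum (φ := fun z => z ^ (-s)) (p := 0) (e := e)
      (w := fun y => Real.exp (Real.pi * |(-s).im|) * y ^ (-s).re)
      (C := Real.exp (Real.pi * |(-s).im|) * b ^ (-s).re) hb he0 he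
      (differentiableOn_cpow_const _)
      (fun y hy => by
        have := Real.rpow_le_rpow_of_nonpos hb hy hs0.le
        gcongr)
      (tendsto_const_mul_rpow_neg hs0)
      (fun u t hu ht => norm_cpow_wedge_le hb he0 hs0 hu ht)
      (fun u t hu ht => by
        have := norm_cpow_wedge_le (e := conj e) hb hc0 hs0 hu ht
        rwa [Complex.conj_re] at this) h2
      (integrableOn_Ioi_cpow_of_lt hs1 hb)
    rw [integral_Ioi_cpow_of_lt hs1 hb] at h3
    have h4 : -s + 1 ≠ 0 := by
      intro h
      have := congrArg Complex.re h
      simp at this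
      linarith
    have h5 : s - 1 ≠ 0 := by
      intro h
      apply h4
      linear_combination -h
    have h6 : -(b : ℂ) ^ (-s + 1) / (-s + 1) = (b : ℂ) ^ (1 - s) / (s - 1) := by
      rw [show -s + 1 = 1 - s by ring, show 1 - s = -(s - 1) by ring, neg_div_neg_eq]
    rw [h6] at h3
    linear_combination h3
  refine AnalyticOnNhd.eqOn_of_preconnected_of_eventuallyEq (𝕜 := ℂ)
    (f := fun s => hurwitzZetaPos s a)
    (g := fun s => (a : ℂ) ^ (-s) + (b : ℂ) ^ (1 - s) / (s - 1) -
      rayIntegral e (fun z => z ^ (-s)) b) (U := {1}ᶜ) (z₀ := 2) ?_ ?_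
    (isConnected_compl_singleton_of_one_lt_rank (by simp) 1).isPreconnected (by simp) ?_ hs
  · refine DifferentiableOn.analyticOnNhd (fun s hs => ?_) isOpen_compl_singleton
    exact (differentiableAt_hurwitzZetaPos hs).differentiableWithinAt
  · refine DifferentiableOn.analyticOnNhd (fun s hs => ?_) isOpen_compl_singleton
    refine DifferentiableAt.differentiableWithinAt ?_
    refine (DifferentiableAt.add ?_ (DifferentiableAt.div ?_ (by fun_prop) ?_)).sub ?_
    · exact differentiableAt_id.neg.const_cpow (Or.inl ha')
    · exact (differentiableAt_id.const_sub 1).const_cpow (Or.inl hb')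
    · exact sub_ne_zero.mpr hs
    · exact ((differentiable_rayIntegral_cpow hb he0 he he1) (-s)).comp s differentiableAt_id.neg
  · filter_upwards [(isOpen_lt continuous_const Complex.continuous_re).mem_nhds
      (by simp : (1 : ℝ) < (2 : ℂ).re)] with s hs
    exact hhalf s hs

/-! ### The digamma function -/

/-- The recurrence and the bounds `log y - 1 / y ≤ Γ'(y) / Γ(y) ≤ log y`, from the convexity of
`log ∘ Γ`. -/
theorem log_sub_inv_le_logDeriv_Gamma_and_le {y : ℝ} (hy : 0 < y) :
    deriv Real.Gamma (y + 1) / Real.Gamma (y + 1) = deriv Real.Gamma y / Real.Gamma y + 1 / y ∧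
    Real.log y - 1 / y ≤ deriv Real.Gamma y / Real.Gamma y ∧
    deriv Real.Gamma y / Real.Gamma y ≤ Real.log y := by
  have hG : ∀ y : ℝ, 0 < y → HasDerivAt (Real.log ∘ Real.Gamma)
      (deriv Real.Gamma y / Real.Gamma y) y := by
    intro y hy
    have h1 : DifferentiableAt ℝ Real.Gamma y := Real.differentiableAt_Gamma fun m h => by
      have : (0 : ℝ) ≤ m := m.cast_nonneg
      linarith
    exact h1.hasDerivAt.log (Real.Gamma_pos_of_pos hy).ne'
  have hrec : ∀ y : ℝ, 0 < y →
      (Real.log ∘ Real.Gamma) (y + 1) = Real.log y + (Real.log ∘ Real.Gamma) y := by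
    intro y hy
    simp only [Function.comp]
    rw [Real.Gamma_add_one hy.ne', Real.log_mul hy.ne' (Real.Gamma_pos_of_pos hy).ne']
  have hy1 : 0 < y + 1 := by positivity
  have e1 : deriv Real.Gamma (y + 1) / Real.Gamma (y + 1) =
      deriv Real.Gamma y / Real.Gamma y + 1 / y := by
    have d1 := (hG (y + 1) hy1).comp_add_const y 1
    have d2 : HasDerivAt (fun z => (Real.log ∘ Real.Gamma) (z + 1))
        (y⁻¹ + deriv Real.Gamma y / Real.Gamma y) y :=
      ((Real.hasDerivAt_log hy.ne').add (hG y hy)).congr_of_eventuallyEq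
        (by filter_upwards [lt_mem_nhds hy] with z hz using hrec z hz)
    rw [d1.unique d2]
    ring
  have hsl : slope (Real.log ∘ Real.Gamma) y (y + 1) = Real.log y := by
    rw [slope_def_field, hrec y hy]
    ring
  have hle := Real.convexOn_log_Gamma.le_slope_of_hasDerivAt (mem_Ioi.mpr hy) (mem_Ioi.mpr hy1)
    (by linarith) (hG y hy)
  have hge := Real.convexOn_log_Gamma.slope_le_of_hasDerivAt (mem_Ioi.mpr hy) (mem_Ioi.mpr hy1)
    (by linarith) (hG (y + 1) hy1)
  rw [hsl] at hle hge
  exact ⟨e1, by linarith, hle⟩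

/-- Gauss's limit formula for the digamma function. -/
theorem tendsto_sum_inv_sub_log {y : ℝ} (hy : 0 < y) :
    Tendsto (fun n : ℕ => ∑ k ∈ Finset.range n, 1 / (y + k) - Real.log (y + n)) atTop
      (𝓝 (-(deriv Real.Gamma y / Real.Gamma y))) := by
  set ψ : ℝ → ℝ := fun y => deriv Real.Gamma y / Real.Gamma y
  have hsum : ∀ n : ℕ, ∑ k ∈ Finset.range n, 1 / (y + k) = ψ (y + n) - ψ y := by
    intro n
    induction n with
    | zero => simp
    | succ n ih =>
      rw [Finset.sum_range_succ, ih]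
      have := (log_sub_inv_le_logDeriv_Gamma_and_le (y := y + n) (by positivity)).1
      push_cast
      rw [← add_assoc]
      simp only [ψ] at this ⊢
      rw [this]
      ring
  have hlim : Tendsto (fun n : ℕ => ψ (y + n) - Real.log (y + n)) atTop (𝓝 0) := by
    have h1 : Tendsto (fun n : ℕ => -(1 / (y + n))) atTop (𝓝 0) := by
      have : Tendsto (fun n : ℕ => y + (n : ℝ)) atTop atTop :=
        tendsto_atTop_add_const_left _ _ tendsto_natCast_atTop_atTop
      simpa using (tendsto_inv_atTop_zero.comp this).neg
    refine tendsto_of_tendsto_of_tendsto_of_le_of_le h1 tendsto_const_nhds (fun n => ?_) fun n => ?_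
    · have := (log_sub_inv_le_logDeriv_Gamma_and_le (y := y + n) (by positivity)).2.1
      simp only [ψ]
      linarith
    · have := (log_sub_inv_le_logDeriv_Gamma_and_le (y := y + n) (by positivity)).2.2
      simp only [ψ]
      linarith
  have := hlim.sub_const (ψ y)
  rw [zero_sub] at this
  refine this.congr fun n => ?_
  rw [hsum]
  ring

/-- The value of the correction term at the exponent `-1`, where the zeta function has its pole. -/
theorem rayIntegral_cpow_neg_one {a : ℝ} {e : ℂ} (ha : 0 < a) (he0 : 0 ≤ e.re) (he : 0 < e.im) :
    rayIntegral e (fun z => z ^ (-1 : ℂ)) (a + 1 / 2) =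
      ((deriv Real.Gamma a / Real.Gamma a + 1 / a - Real.log (a + 1 / 2) : ℝ) : ℂ) := by
  set b := a + 1 / 2 with hbdef
  have hb : 0 < b := by positivity
  have hc0 : 0 ≤ (conj e).re := by simpa using he0
  have hs0 : (-1 : ℂ).re < 0 := by simp
  have h1 := abelPlana_tendsto (φ := fun z => z ^ (-1 : ℂ)) (p := 0) (e := e)
      (w := fun y => Real.exp (Real.pi * |(-1 : ℂ).im|) * y ^ (-1 : ℂ).re)
      (C := Real.exp (Real.pi * |(-1 : ℂ).im|) * b ^ (-1 : ℂ).re) hb he0 he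
      (differentiableOn_cpow_const _)
      (fun y hy => by
        have := Real.rpow_le_rpow_of_nonpos hb hy hs0.le
        gcongr)
      (tendsto_const_mul_rpow_neg hs0)
      (fun u t hu ht => norm_cpow_wedge_le hb he0 hs0 hu ht)
      (fun u t hu ht => by
        have := norm_cpow_wedge_le (e := conj e) hb hc0 hs0 hu ht
        rwa [Complex.conj_re] at this)
  have h2 : ∀ n : ℕ, (∑ k ∈ Finset.range n, ((b : ℂ) + 1 / 2 + k) ^ (-1 : ℂ)) -
      ∫ u in b..(b + n), (u : ℂ) ^ (-1 : ℂ) =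
      ((∑ k ∈ Finset.range n, 1 / (a + 1 + k) - (Real.log (b + n) - Real.log b) : ℝ) : ℂ) := by
    intro n
    have hbn : 0 < b + n := by positivity
    have e1 : ∫ u in b..(b + n), (u : ℂ) ^ (-1 : ℂ) =
        ((∫ u in b..(b + n), u⁻¹ : ℝ) : ℂ) := by
      rw [← intervalIntegral.integral_ofReal]
      refine intervalIntegral.integral_congr fun u hu => ?_
      simp [Complex.cpow_neg_one]
    rw [e1, integral_inv_of_pos hb hbn, Real.log_div hbn.ne' hb.ne']
    rw [hbdef]
    push_cast
    refine congrArg₂ _ (Finset.sum_congr rfl fun k _ => ?_) rfl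
    rw [Complex.cpow_neg_one, one_div]
    ring
  simp_rw [h2] at h1
  have h3 := tendsto_sum_inv_sub_log (y := a + 1) (by positivity)
  have h4 : Tendsto (fun n : ℕ => Real.log (a + 1 + n) - Real.log (b + n)) atTop (𝓝 0) := by
    have e1 : Tendsto (fun n : ℕ => (1 : ℝ) + (1 / 2) / (b + n)) atTop (𝓝 1) := by
      have : Tendsto (fun n : ℕ => b + (n : ℝ)) atTop atTop :=
        tendsto_atTop_add_const_left _ _ tendsto_natCast_atTop_atTop
      simpa using (this.const_div_atTop (1 / 2)).const_add 1
    have e2 := (Real.continuousAt_log one_ne_zero).tendsto.comp e1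
    rw [Real.log_one] at e2
    refine e2.congr fun n => ?_
    have hbn : 0 < b + n := by positivity
    have han : 0 < a + 1 + n := by positivity
    simp only [Function.comp]
    rw [← Real.log_div han.ne' hbn.ne']
    congr 1
    field_simp
    rw [hbdef]
    ring
  have h5 := (h3.add h4).add_const (Real.log b)
  have h6 := (Complex.continuous_ofReal.tendsto _).comp h5
  have h7 := tendsto_nhds_unique h1 (h6.congr fun n => by
    simp only [Function.comp]
    congr 1
    ring)
  rw [(log_sub_inv_le_logDeriv_Gamma_and_le ha).1] at h7
  rw [neg_eq_iff_eq_neg] at h7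
  rw [h7, ← Complex.ofReal_neg]
  congr 1
  ring

/-! ### The incomplete Gamma integral -/

/-- The integral of `t ^ γ * exp (-x t ^ α)` over `(b, ∞)`, an incomplete Gamma function up to
normalization. -/
noncomputable def incompleteIntegral (γ α x b : ℝ) : ℝ :=
  ∫ t in Ioi b, t ^ γ * Real.exp (-x * t ^ α)

/-- The integral over `(0, b)` of the `k`-th term of the exponential series, for the integrand of
`incompleteIntegral`.  If `γ + α k + 1 = 0`, the term has the value `0` by the
convention for division by zero. -/
noncomputable def incompleteTerm (γ α x b : ℝ) (k : ℕ) : ℝ :=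
  (-x) ^ k / k.factorial * (b ^ (γ + α * k + 1) / (γ + α * k + 1))

theorem integrableOn_rpow_mul_exp_neg_Ioi (γ : ℝ) {α x b : ℝ} (hα : 0 < α) (hx : 0 < x)
    (hb : 0 < b) : IntegrableOn (fun t : ℝ => t ^ γ * Real.exp (-x * t ^ α)) (Ioi b) := by
  have hsub : Ioi b ⊆ Ioi 0 := Ioi_subset_Ioi hb.le
  rcases lt_or_ge (-1) γ with h | h
  · exact (integrableOn_rpow_mul_exp_neg_mul_rpow h hα hx).mono_set hsub
  · have h0 := ((integrableOn_rpow_mul_exp_neg_mul_rpow (s := 0) (by norm_num) hα hx).mono_set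
      hsub).const_mul (b ^ γ)
    refine h0.mono' ?_ ?_
    · refine ContinuousOn.aestronglyMeasurable (fun t ht => ?_) measurableSet_Ioi
      have ht0 : t ≠ 0 := (hb.trans ht).ne'
      exact ((Real.continuousAt_rpow_const _ _ (Or.inl ht0)).mul
        ((Real.continuousAt_rpow_const _ _ (Or.inl ht0)).const_mul _).rexp).continuousWithinAt
    · refine (ae_restrict_iff' measurableSet_Ioi).mpr (ae_of_all _ fun t ht => ?_)
      have ht0 : 0 < t := hb.trans ht
      rw [Real.norm_of_nonneg (by positivity), Real.rpow_zero, one_mul]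
      gcongr ?_ * _
      exact Real.rpow_le_rpow_of_nonpos hb (le_of_lt ht) (by linarith)

theorem tendsto_rpow_mul_exp_neg_mul_rpow (γ : ℝ) {α x : ℝ} (hα : 0 < α) (hx : 0 < x) :
    Tendsto (fun t : ℝ => t ^ γ * Real.exp (-x * t ^ α)) atTop (𝓝 0) := by
  have h := (tendsto_rpow_mul_exp_neg_mul_atTop_nhds_zero (γ / α) x hx).comp (tendsto_rpow_atTop hα)
  refine h.congr' ?_
  filter_upwards [eventually_gt_atTop 0] with t ht
  simp only [Function.comp]
  rw [← Real.rpow_mul ht.le, mul_div_cancel₀ _ hα.ne']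

/-- Integration by parts. -/
theorem add_one_mul_incompleteIntegral (γ : ℝ) {α x b : ℝ} (hα : 0 < α) (hx : 0 < x) (hb : 0 < b) :
    (γ + 1) * incompleteIntegral γ α x b =
      x * α * incompleteIntegral (γ + α) α x b - b ^ (γ + 1) * Real.exp (-x * b ^ α) := by
  have hd : ∀ t ∈ Ioi b, HasDerivAt (fun t : ℝ => t ^ (γ + 1) * Real.exp (-x * t ^ α))
      ((γ + 1) * (t ^ γ * Real.exp (-x * t ^ α)) -
        x * α * (t ^ (γ + α) * Real.exp (-x * t ^ α))) t := by
    intro t ht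
    have ht0 : 0 < t := hb.trans ht
    have h1 := Real.hasDerivAt_rpow_const (p := γ + 1) (Or.inl ht0.ne')
    have h2 := ((Real.hasDerivAt_rpow_const (p := α) (Or.inl ht0.ne')).const_mul (-x)).exp
    refine (h1.mul h2).congr_deriv ?_
    have e1 : t ^ (γ + α) = t ^ (γ + 1) * t ^ (α - 1) := by
      rw [← Real.rpow_add ht0]; ring_nf
    rw [add_sub_cancel_right, e1]
    ring
  have i1 := (integrableOn_rpow_mul_exp_neg_Ioi γ hα hx hb).const_mul (γ + 1)
  have i2 := (integrableOn_rpow_mul_exp_neg_Ioi (γ + α) hα hx hb).const_mul (x * α)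
  have hcont : ContinuousWithinAt (fun t : ℝ => t ^ (γ + 1) * Real.exp (-x * t ^ α)) (Ici b) b :=
    ((Real.continuousAt_rpow_const _ _ (Or.inl hb.ne')).mul
        ((Real.continuousAt_rpow_const _ _ (Or.inl hb.ne')).const_mul _).rexp).continuousWithinAt
  have h := integral_Ioi_of_hasDerivAt_of_tendsto hcont hd (i1.sub i2)
    (tendsto_rpow_mul_exp_neg_mul_rpow (γ + 1) hα hx)
  rw [integral_sub i1 i2, integral_const_mul, integral_const_mul] at h
  unfold incompleteIntegral
  linarith

theorem hasSum_exp_neg_mul_rpow {t : ℝ} (ht : 0 < t) (γ α x : ℝ) :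
    HasSum (fun k : ℕ => (-x) ^ k / k.factorial * t ^ (γ + α * k))
      (t ^ γ * Real.exp (-x * t ^ α)) := by
  have h := (NormedSpace.expSeries_div_hasSum_exp (-x * t ^ α)).mul_left (t ^ γ)
  rw [← Real.exp_eq_exp_ℝ] at h
  refine h.congr_fun fun k => ?_
  rw [Real.rpow_add ht, Real.rpow_mul ht.le, Real.rpow_natCast, mul_pow]
  ring

theorem hasSum_incompleteTerm_of_pos {γ α x b : ℝ} (hγ : -1 < γ) (hα : 0 < α) (hx : 0 < x)
    (hb : 0 < b) :
    HasSum (incompleteTerm γ α x b) (gammaTerm γ α x - incompleteIntegral γ α x b) := by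
  have htot := integrableOn_rpow_mul_exp_neg_mul_rpow hγ hα hx
  have hsplit := setIntegral_union (Ioc_disjoint_Ioi (le_refl b)) measurableSet_Ioi
    (htot.mono_set (Ioc_subset_Ioi_self : Ioc 0 b ⊆ Ioi 0))
    (integrableOn_rpow_mul_exp_neg_Ioi γ hα hx hb)
  rw [Ioc_union_Ioi_eq_Ioi hb.le, integral_rpow_mul_exp_neg_mul_rpow hα hγ hx] at hsplit
  have hval : gammaTerm γ α x - incompleteIntegral γ α x b =
      ∫ t in Ioc 0 b, t ^ γ * Real.exp (-x * t ^ α) := by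
    unfold gammaTerm incompleteIntegral
    rw [← neg_div]
    linarith
  have hpos : ∀ k : ℕ, -1 < γ + α * k := fun k => by
    have : 0 ≤ α * k := by positivity
    linarith
  have hint : ∀ k : ℕ, ∫ t in Ioc 0 b, t ^ (γ + α * k) = b ^ (γ + α * k + 1) / (γ + α * k + 1) := by
    intro k
    rw [← intervalIntegral.integral_of_le hb.le, integral_rpow (Or.inl (hpos k)), Real.zero_rpow,
      sub_zero]
    linarith [hpos k]
  have hi : ∀ k : ℕ, IntegrableOn (fun t : ℝ => t ^ (γ + α * k)) (Ioc 0 b) := fun k => by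
    rw [← intervalIntegrable_iff_integrableOn_Ioc_of_le hb.le]
    exact intervalIntegral.intervalIntegrable_rpow' (hpos k)
  have hnorm : ∀ k : ℕ, ∫ t in Ioc 0 b, ‖(-x) ^ k / k.factorial * t ^ (γ + α * k)‖ =
      x ^ k / k.factorial * (b ^ (γ + α * k + 1) / (γ + α * k + 1)) := by
    intro k
    rw [← hint k, ← integral_const_mul]
    refine setIntegral_congr_fun measurableSet_Ioc fun t ht => ?_
    have := ht.1
    simp only [norm_mul, norm_div, norm_pow, norm_neg, Real.norm_natCast]
    rw [Real.norm_of_nonneg hx.le, Real.norm_of_nonneg (by positivity)]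
  have hsum : Summable fun k : ℕ => ∫ t in Ioc 0 b, ‖(-x) ^ k / k.factorial * t ^ (γ + α * k)‖ := by
    simp_rw [hnorm]
    refine Summable.of_nonneg_of_le (fun k => ?_) (fun k => ?_)
      ((Real.summable_pow_div_factorial (x * b ^ α)).mul_left (b ^ (γ + 1) / (γ + 1)))
    · have := hpos k
      have : 0 < γ + α * k + 1 := by linarith
      positivity
    · have h0 : 0 < γ + 1 := by linarith
      have h1 : γ + 1 ≤ γ + α * k + 1 := by
        have : 0 ≤ α * k := by positivity
        linarith
      have h2 : b ^ (γ + α * k + 1) = b ^ (γ + 1) * (b ^ α) ^ k := by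
        rw [← Real.rpow_natCast, ← Real.rpow_mul hb.le, ← Real.rpow_add hb]
        ring_nf
      calc _ ≤ x ^ k / k.factorial * (b ^ (γ + α * k + 1) / (γ + 1)) := by gcongr
        _ = _ := by rw [h2, mul_pow]; ring
  have h := hasSum_integral_of_summable_integral_norm (μ := volume.restrict (Ioc 0 b))
    (fun k => (hi k).const_mul ((-x) ^ k / k.factorial)) hsum
  rw [hval]
  have e1 : ∫ t in Ioc 0 b, ∑' k : ℕ, (-x) ^ k / k.factorial * t ^ (γ + α * k) =
      ∫ t in Ioc 0 b, t ^ γ * Real.exp (-x * t ^ α) :=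
    setIntegral_congr_fun measurableSet_Ioc fun t ht => (hasSum_exp_neg_mul_rpow ht.1 γ α x).tsum_eq
  rw [e1] at h
  refine h.congr_fun fun k => ?_
  rw [integral_const_mul, hint]
  rfl

/-- The series counterpart of the integration by parts.  The constant `D` is the contribution of
an index at which `incompleteTerm` has a vanishing denominator. -/
theorem hasSum_incompleteTerm_step {γ α x b D G : ℝ} (hα : 0 < α) (hx : 0 < x)
    (hb : 0 < b) (hγ : γ + 1 ≠ 0)
    (hD : HasSum (fun k : ℕ => if γ + α * k + 1 = 0 then (-x) ^ k / (k.factorial : ℝ) else 0) D)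
    (h : HasSum (incompleteTerm (γ + α) α x b) (G - incompleteIntegral (γ + α) α x b)) :
    HasSum (incompleteTerm γ α x b) ((x * α * G - D) / (γ + 1) - incompleteIntegral γ α x b) := by
  have h1 : HasSum (fun k : ℕ => if k = 0 then 0 else incompleteTerm (γ + α) α x b (k - 1))
      (G - incompleteIntegral (γ + α) α x b) := by
    rw [← hasSum_nat_add_iff' 1]
    simpa using h
  have h2 := ((((hasSum_exp_neg_mul_rpow hb (γ + 1) α x).add (h1.mul_left (x * α))).sub hD).mul_left
    (γ + 1)⁻¹)
  have hI := add_one_mul_incompleteIntegral γ hα hx hb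
  have hv : (γ + 1)⁻¹ * (b ^ (γ + 1) * Real.exp (-x * b ^ α) +
      x * α * (G - incompleteIntegral (γ + α) α x b) - D) =
      (x * α * G - D) / (γ + 1) - incompleteIntegral γ α x b := by
    have hI' : incompleteIntegral γ α x b = (x * α * incompleteIntegral (γ + α) α x b -
        b ^ (γ + 1) * Real.exp (-x * b ^ α)) / (γ + 1) := by
      rw [eq_div_iff hγ]
      linarith
    rw [hI']
    generalize Real.exp (-x * b ^ α) = E
    field_simp
    ring
  rw [hv] at h2
  refine h2.congr_fun fun k => ?_
  unfold incompleteTerm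
  rw [eq_inv_mul_iff_mul_eq₀ hγ]
  rcases k with _ | k
  · have : γ + α * (0 : ℕ) + 1 ≠ 0 := by simpa using hγ
    rw [if_neg this]
    simp
    field_simp
  · have e1 : γ + 1 + α * ((k + 1 : ℕ) : ℝ) = γ + α * ((k + 1 : ℕ) : ℝ) + 1 := by ring
    have e2 : γ + α + α * ((k + 1 - 1 : ℕ) : ℝ) + 1 = γ + α * ((k + 1 : ℕ) : ℝ) + 1 := by
      push_cast [Nat.add_sub_cancel]; ring
    rw [e1, e2, if_neg (Nat.succ_ne_zero k), Nat.add_sub_cancel, Nat.factorial_succ]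
    have hk : (k.factorial : ℝ) ≠ 0 := by positivity
    have hk1 : (k : ℝ) + 1 ≠ 0 := by positivity
    split_ifs with h0
    · rw [h0, Real.rpow_zero]
      push_cast
      simp
    · push_cast at h0 ⊢
      generalize hq : γ + α * ((k : ℝ) + 1) + 1 = q at h0 ⊢
      have hγq : γ + 1 = q - α * (k + 1) := by linarith
      rw [hγq]
      field_simp
      ring

theorem tendsto_incompleteIntegral {α x b : ℝ} (hα : 0 < α) (hx : 0 < x) (hb : 0 < b) :
    Tendsto (fun δ : ℝ => incompleteIntegral (-1 + α * δ) α x b) (𝓝[>] 0)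
      (𝓝 (incompleteIntegral (-1) α x b)) := by
  have i1 := integrableOn_rpow_mul_exp_neg_Ioi (-1) hα hx hb
  have i2 := integrableOn_rpow_mul_exp_neg_Ioi α hα hx hb
  refine tendsto_integral_filter_of_dominated_convergence _ ?_ ?_ (i1.add i2) ?_
  · exact Eventually.of_forall fun δ =>
      (integrableOn_rpow_mul_exp_neg_Ioi _ hα hx hb).aestronglyMeasurable
  · filter_upwards [Ioo_mem_nhdsGT (zero_lt_one' ℝ)] with δ hδ
    refine (ae_restrict_iff' measurableSet_Ioi).mpr (ae_of_all _ fun t ht => ?_)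
    have ht0 : 0 < t := hb.trans ht
    simp only [Pi.add_apply]
    rw [Real.norm_of_nonneg (by positivity), ← add_mul]
    gcongr ?_ * _
    have h1 : 0 ≤ α * δ := mul_nonneg hα.le hδ.1.le
    have h2 : α * δ ≤ α := by nlinarith [hδ.2]
    rcases le_total 1 t with h | h
    · have := Real.rpow_le_rpow_of_exponent_le h (by linarith : -1 + α * δ ≤ α)
      have : 0 < t ^ (-1 : ℝ) := by positivity
      linarith
    · have := Real.rpow_le_rpow_of_exponent_ge ht0 h (by linarith : -1 ≤ -1 + α * δ)
      have : 0 < t ^ α := by positivity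
      linarith
  · refine (ae_restrict_iff' measurableSet_Ioi).mpr (ae_of_all _ fun t ht => ?_)
    have ht0 : 0 < t := hb.trans ht
    refine Tendsto.mul_const _ ?_
    have : ContinuousAt (fun δ : ℝ => t ^ (-1 + α * δ)) 0 :=
      (Real.continuousAt_const_rpow ht0.ne').comp (by fun_prop)
    have h := this.tendsto
    simp only [mul_zero, add_zero] at h
    exact h.mono_left nhdsWithin_le_nhds

/-- The case of the vanishing index `0`, by a limit in the exponent. -/
theorem hasSum_incompleteTerm_neg_one {α x b : ℝ} (hα : 0 < α) (hx : 0 < x) (hb : 0 < b) :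
    HasSum (incompleteTerm (-1) α x b)
      ((-Real.log x / α + deriv Real.Gamma 1 * (1 / α) - Real.log b) -
        incompleteIntegral (-1) α x b) := by
  set F : ℝ → ℕ → ℝ := fun δ k => if k = 0 then 0 else incompleteTerm (-1 + α * δ) α x b k with hF
  set bd : ℕ → ℝ := fun k => (1 + b ^ α) / α * ((x * b ^ α) ^ k / k.factorial)
  have hbd : Summable bd := (Real.summable_pow_div_factorial (x * b ^ α)).mul_left _
  have hle : ∀ δ ∈ Ico (0 : ℝ) 1, ∀ k, ‖F δ k‖ ≤ bd k := by
    intro δ hδ k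
    rcases Nat.eq_zero_or_pos k with rfl | hk
    · simp only [hF, if_true, norm_zero, bd]
      positivity
    · have hk1 : (1 : ℝ) ≤ k := by exact_mod_cast hk
      have h1 : 0 ≤ α * δ := mul_nonneg hα.le hδ.1
      have h2 : α * δ ≤ α := by nlinarith [hδ.2]
      have h3 : α ≤ -1 + α * δ + α * k + 1 := by nlinarith
      have h4 : b ^ (-1 + α * δ + α * k + 1) = b ^ (α * δ) * (b ^ α) ^ k := by
        rw [← Real.rpow_natCast, ← Real.rpow_mul hb.le, ← Real.rpow_add hb]
        ring_nf
      have h5 : b ^ (α * δ) ≤ 1 + b ^ α := by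
        have : 0 < b ^ α := by positivity
        rcases le_total 1 b with h | h
        · have := Real.rpow_le_rpow_of_exponent_le h h2
          linarith
        · have := Real.rpow_le_one hb.le h h1
          linarith
      simp only [hF, if_neg hk.ne', incompleteTerm, norm_mul, norm_div, norm_pow, norm_neg,
        Real.norm_natCast]
      rw [Real.norm_of_nonneg hx.le, Real.norm_of_nonneg (by linarith : 0 ≤ -1 + α * δ + α * k + 1),
        Real.norm_of_nonneg (by positivity : 0 ≤ b ^ (-1 + α * δ + α * k + 1)), h4]
      calc _ ≤ x ^ k / k.factorial * ((1 + b ^ α) * (b ^ α) ^ k / α) := by gcongr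
        _ = _ := by simp only [bd, mul_pow]; ring
  have hF0 : F 0 = incompleteTerm (-1) α x b := by
    funext k
    rcases Nat.eq_zero_or_pos k with rfl | hk
    · simp [hF, incompleteTerm]
    · simp [hF, hk.ne']
  have hlim : Tendsto (fun δ => ∑' k, F δ k) (𝓝[>] 0) (𝓝 (∑' k, F 0 k)) := by
    refine tendsto_tsum_of_dominated_convergence hbd (fun k => ?_) ?_
    · rcases Nat.eq_zero_or_pos k with rfl | hk
      · simp [hF]
      · simp only [hF, if_neg hk.ne', incompleteTerm]
        refine Tendsto.mono_left ?_ nhdsWithin_le_nhds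
        have hk1 : (1 : ℝ) ≤ k := by exact_mod_cast hk
        have : ContinuousAt (fun δ : ℝ => (-x) ^ k / (k.factorial : ℝ) *
            (b ^ (-1 + α * δ + α * k + 1) / (-1 + α * δ + α * k + 1))) 0 := by
          refine continuousAt_const.mul (ContinuousAt.div ?_ (by fun_prop) ?_)
          · exact (Real.continuousAt_const_rpow hb.ne').comp (by fun_prop)
          · have : 0 < α * k := by positivity
            simp
            exact ⟨hα.ne', by omega⟩
        exact this.tendsto
    · filter_upwards [Ioo_mem_nhdsGT (zero_lt_one' ℝ)] with δ hδ k
      exact hle δ ⟨hδ.1.le, hδ.2⟩ k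
  have hslope : Tendsto
      (fun δ : ℝ => gammaTerm (-1 + α * δ) α x - incompleteTerm (-1 + α * δ) α x b 0)
      (𝓝[>] 0) (𝓝 (-Real.log x / α + deriv Real.Gamma 1 * (1 / α) - Real.log b)) := by
    have d1 : HasDerivAt (fun δ : ℝ => Real.Gamma (δ + 1)) (deriv Real.Gamma 1) 0 := by
      have : HasDerivAt Real.Gamma (deriv Real.Gamma 1) (0 + 1) := by
        rw [zero_add]
        refine (Real.differentiableAt_Gamma fun m h => ?_).hasDerivAt
        have : (0 : ℝ) ≤ m := m.cast_nonneg
        linarith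
      exact this.comp_add_const 0 1
    have d2 : HasDerivAt (fun δ : ℝ => x ^ (-δ)) (-Real.log x) 0 := by
      have := (hasDerivAt_neg (0 : ℝ)).const_rpow hx
      simpa using this
    have d3 : HasDerivAt (fun δ : ℝ => b ^ (α * δ)) (α * Real.log b) 0 := by
      have := ((hasDerivAt_id (0 : ℝ)).const_mul α).const_rpow hb
      simpa [mul_comm] using this
    have d := (((d1.mul d2).sub d3).const_mul (1 / α)).tendsto_slope_zero_right
    have hv : 1 / α * (deriv Real.Gamma 1 * x ^ (-(0 : ℝ)) +
        Real.Gamma (0 + 1) * -Real.log x - α * Real.log b) =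
        -Real.log x / α + deriv Real.Gamma 1 * (1 / α) - Real.log b := by
      simp
      field_simp
      ring
    rw [hv] at d
    refine d.congr' ?_
    filter_upwards [self_mem_nhdsWithin] with δ hδ
    have hδ0 : (0 : ℝ) < δ := hδ
    have e1 : (-1 + α * δ + 1) / α = δ := by field_simp; ring
    have e2 : -1 + α * δ + 1 = α * δ := by ring
    simp only [gammaTerm, incompleteTerm, smul_eq_mul, e1, zero_add, Pi.mul_apply, Pi.sub_apply]
    rw [Real.Gamma_add_one hδ0.ne']
    simp [e2]
    field_simp
  have hev : ∀ᶠ δ in 𝓝[>] (0 : ℝ), ∑' k, F δ k = gammaTerm (-1 + α * δ) α x -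
      incompleteTerm (-1 + α * δ) α x b 0 - incompleteIntegral (-1 + α * δ) α x b := by
    filter_upwards [self_mem_nhdsWithin] with δ hδ
    have hpos : 0 < α * δ := mul_pos hα hδ
    have h1 := hasSum_incompleteTerm_of_pos (γ := -1 + α * δ) (by linarith) hα hx hb
    have h2 : HasSum (F δ) (gammaTerm (-1 + α * δ) α x - incompleteIntegral (-1 + α * δ) α x b -
        incompleteTerm (-1 + α * δ) α x b 0) := by
      rw [← hasSum_nat_add_iff' 1] at h1 ⊢
      simpa [hF] using h1
    rw [h2.tsum_eq]
    ring
  have huniq := tendsto_nhds_unique hlim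
    ((hslope.sub (tendsto_incompleteIntegral hα hx hb)).congr' (hev.mono fun δ h => h.symm))
  have hsm : Summable (F 0) := Summable.of_norm_bounded hbd (hle 0 ⟨le_rfl, one_pos⟩)
  have := hsm.hasSum
  rw [huniq, hF0] at this
  exact this

/-- The expansion of the incomplete Gamma integral if no index has a vanishing denominator.  The
case `γ > -1` is reached by repeated integration by parts. -/
theorem hasSum_incompleteTerm_of_ne {γ α x b : ℝ} (hα : 0 < α) (hx : 0 < x) (hb : 0 < b)
    (hγ : ∀ r : ℕ, -((γ + 1) / α) ≠ r) :
    HasSum (incompleteTerm γ α x b) (gammaTerm γ α x - incompleteIntegral γ α x b) := by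
  obtain ⟨n, hn⟩ := exists_nat_gt (-((γ + 1) / α))
  induction n generalizing γ with
  | zero =>
    refine hasSum_incompleteTerm_of_pos ?_ hα hx hb
    have : 0 < (γ + 1) / α := by simpa using hn
    rw [div_pos_iff_of_pos_right hα] at this
    linarith
  | succ n ih =>
    have hs : -((γ + α + 1) / α) = -((γ + 1) / α) - 1 := by field_simp; ring
    have hstep := ih (γ := γ + α)
      (fun r h => hγ (r + 1) (by rw [hs] at h; push_cast; linarith))
      (by rw [hs]; push_cast at hn; linarith)
    have hγ1 : γ + 1 ≠ 0 := fun h => hγ 0 (by simp [h])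
    have h := hasSum_incompleteTerm_step (D := 0) hα hx hb hγ1 ?_ hstep
    · convert h using 2
      unfold gammaTerm
      have e1 : (γ + α + 1) / α = (γ + 1) / α + 1 := by field_simp; ring
      have hq : (γ + 1) / α ≠ 0 := div_ne_zero hγ1 hα.ne'
      rw [e1, Real.Gamma_add_one hq, neg_add, Real.rpow_add hx, Real.rpow_neg_one]
      field_simp
      ring
    · have : (fun k : ℕ => if γ + α * k + 1 = 0 then (-x) ^ k / (k.factorial : ℝ) else 0) = 0 := by
        funext k
        refine if_neg fun h => hγ k ?_
        rw [← neg_div, div_eq_iff hα.ne']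
        linarith
      rw [this]
      exact hasSum_zero

/-- The expansion of the incomplete Gamma integral if the index `r` has a vanishing denominator. -/
theorem hasSum_incompleteTerm_of_eq {γ α x b : ℝ} (hα : 0 < α) (hx : 0 < x) (hb : 0 < b) {r : ℕ}
    (hγ : -((γ + 1) / α) = r) :
    HasSum (incompleteTerm γ α x b)
      ((-1) ^ r * x ^ r / Real.Gamma (r + 1) * (-Real.log x / α +
        deriv Real.Gamma (r + 1) / Real.Gamma (r + 1) * (1 / α) - Real.log b) -
        incompleteIntegral γ α x b) := by
  have hγ' : γ = -1 - α * r := by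
    rw [← neg_div, div_eq_iff hα.ne'] at hγ
    linarith
  subst hγ'
  clear hγ
  induction r with
  | zero => simpa using hasSum_incompleteTerm_neg_one hα hx hb
  | succ r ih =>
    have e0 : -1 - α * ((r + 1 : ℕ) : ℝ) + α = -1 - α * r := by push_cast; ring
    have hr : (0 : ℝ) < (r : ℝ) + 1 := by positivity
    have hγ1 : -1 - α * ((r + 1 : ℕ) : ℝ) + 1 ≠ 0 := by
      push_cast
      have : 0 < α * ((r : ℝ) + 1) := by positivity
      intro h
      linarith
    rw [← e0] at ih
    have h := hasSum_incompleteTerm_step (D := (-x) ^ (r + 1) / ((r + 1).factorial : ℝ))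
      hα hx hb hγ1 ?_ ih
    · convert h using 2
      have hψ := (log_sub_inv_le_logDeriv_Gamma_and_le hr).1
      have hG : Real.Gamma ((r : ℝ) + 1) ≠ 0 := (Real.Gamma_pos_of_pos hr).ne'
      push_cast
      rw [hψ, Real.Gamma_add_one hr.ne', Nat.factorial_succ, Nat.cast_mul,
        ← Real.Gamma_nat_eq_factorial]
      have h2 : -1 - α * ((r : ℝ) + 1) + 1 = -(α * (r + 1)) := by ring
      rw [h2, neg_pow x (r + 1)]
      push_cast
      field_simp
      ring
    · have : (fun k : ℕ => if -1 - α * ((r + 1 : ℕ) : ℝ) + α * k + 1 = 0 then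
          (-x) ^ k / (k.factorial : ℝ) else 0) =
          fun k : ℕ => if k = r + 1 then (-x) ^ (r + 1) / ((r + 1).factorial : ℝ) else 0 := by
        funext k
        by_cases hk : k = r + 1
        · subst hk
          rw [if_pos rfl, if_pos (by ring)]
        · rw [if_neg hk, if_neg]
          intro h0
          have h1 : α * ((k : ℝ) - (r + 1 : ℕ)) = 0 := by linarith
          rcases mul_eq_zero.mp h1 with h2 | h2
          · exact hα.ne' h2
          · exact hk (by exact_mod_cast sub_eq_zero.mp h2)
      rw [this]
      exact hasSum_ite_eq _ _

/-! ### The summand as a function of a complex variable -/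

/-- The function `z ^ γ * exp (-x z ^ α)` on the right half-plane. -/
noncomputable def powExp (γ α x : ℝ) (z : ℂ) : ℂ :=
  z ^ (γ : ℂ) * Complex.exp (-(x * z ^ (α : ℂ)))

/-- A direction `e` in the upper right quadrant such that on the sector `|arg z| ≤ arg e`
the real part of `z ^ α` is bounded below by a positive multiple of `(Re z) ^ α`.
For `‖e‖ = 1` the sector is described by the inequality `e.re * ‖z‖ ≤ z.re`. -/
structure IsDampingDirection (α δ : ℝ) (e : ℂ) : Prop where
  re_nonneg : 0 ≤ e.re
  im_pos : 0 < e.im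
  norm_le_one : ‖e‖ ≤ 1
  pos : 0 < δ
  le_re_cpow : ∀ z : ℂ, 0 < z.re → e.re * ‖z‖ ≤ z.re → δ * z.re ^ α ≤ (z ^ (α : ℂ)).re

theorem re_cpow_ofReal {z : ℂ} (hz : z ≠ 0) (α : ℝ) :
    (z ^ (α : ℂ)).re = ‖z‖ ^ α * Real.cos (α * z.arg) := by
  rw [Complex.cpow_def_of_ne_zero hz, Complex.exp_re, Real.rpow_def_of_pos (norm_pos_iff.mpr hz)]
  simp [Complex.log_re, Complex.log_im, mul_comm]

theorem mul_rpow_le_re_cpow {z : ℂ} {α θ : ℝ} (hα : 0 < α) (hz : 0 < z.re) (hθ : |z.arg| ≤ θ)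
    (hαθ : α * θ ≤ Real.pi / 2) : Real.cos (α * θ) * z.re ^ α ≤ (z ^ (α : ℂ)).re := by
  have hz0 : z ≠ 0 := by rintro rfl; simp at hz
  have hθ0 : 0 ≤ θ := (abs_nonneg _).trans hθ
  have hc0 : 0 ≤ Real.cos (α * θ) :=
    Real.cos_nonneg_of_neg_pi_div_two_le_of_le
      (by have : 0 ≤ α * θ := by positivity
          linarith [Real.pi_pos]) hαθ
  have h1 : Real.cos (α * θ) ≤ Real.cos (α * z.arg) := by
    rw [← Real.cos_abs (α * z.arg), abs_mul, abs_of_pos hα]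
    exact Real.cos_le_cos_of_nonneg_of_le_pi (by positivity) (by linarith [Real.pi_pos])
      (by gcongr)
  rw [re_cpow_ofReal hz0, mul_comm]
  have h2 : z.re ^ α ≤ ‖z‖ ^ α := Real.rpow_le_rpow hz.le (Complex.re_le_norm z) hα.le
  gcongr

/-- For `α ≤ 1` the vertical direction is admissible. -/
theorem exists_isDampingDirection_I {α : ℝ} (hα : 0 < α) (hα1 : α ≤ 1) :
    ∃ δ, IsDampingDirection α δ Complex.I := by
  rcases hα1.eq_or_lt with rfl | h
  · exact ⟨1, by simp, by simp, by simp, one_pos, fun z hz _ => by simp⟩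
  · refine ⟨Real.cos (α * (Real.pi / 2)), by simp, by simp, by simp, ?_, fun z hz _ => ?_⟩
    · refine Real.cos_pos_of_mem_Ioo ⟨?_, ?_⟩
      · have : 0 < α * (Real.pi / 2) := by positivity
        linarith [Real.pi_pos]
      · nlinarith [Real.pi_pos]
    · refine mul_rpow_le_re_cpow hα hz ?_ (by nlinarith [Real.pi_pos])
      exact Complex.abs_arg_le_pi_div_two_iff.mpr hz.le

theorem exists_isDampingDirection {α : ℝ} (hα : 0 < α) :
    ∃ (e : ℂ) (δ : ℝ), IsDampingDirection α δ e := by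
  set θ := Real.pi / (4 * max α 1) with hθ
  have hm : 1 ≤ max α 1 := le_max_right _ _
  have hθ0 : 0 < θ := by positivity
  have hθ1 : θ ≤ Real.pi / 4 := by
    rw [hθ]
    gcongr
    linarith
  have hαθ : α * θ ≤ Real.pi / 4 := by
    rw [hθ, mul_div_assoc', div_le_div_iff₀ (by positivity) (by positivity)]
    have := le_max_left α 1
    nlinarith [Real.pi_pos]
  have hαθ0 : 0 < α * θ := by positivity
  have hpi := Real.pi_pos
  refine ⟨Complex.exp (θ * Complex.I), Real.cos (α * θ), ?_, ?_, ?_, ?_, fun z hz h => ?_⟩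
  · rw [Complex.exp_ofReal_mul_I_re]
    exact Real.cos_nonneg_of_neg_pi_div_two_le_of_le (by linarith) (by linarith)
  · rw [Complex.exp_ofReal_mul_I_im]
    exact Real.sin_pos_of_pos_of_lt_pi hθ0 (by linarith)
  · rw [Complex.norm_exp_ofReal_mul_I]
  · exact Real.cos_pos_of_mem_Ioo ⟨by linarith, by linarith⟩
  · refine mul_rpow_le_re_cpow hα hz ?_ (by linarith)
    have hz0 : z ≠ 0 := by rintro rfl; simp at hz
    rw [Complex.exp_ofReal_mul_I_re, ← le_div_iff₀ (norm_pos_iff.mpr hz0),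
      ← Complex.cos_arg hz0, ← Real.cos_abs z.arg] at h
    exact (Real.strictAntiOn_cos.le_iff_ge ⟨hθ0.le, by linarith⟩
      ⟨abs_nonneg _, Complex.abs_arg_le_pi z⟩).mp h

theorem IsDampingDirection.norm_conj_le_one {α δ : ℝ} {e : ℂ} (h : IsDampingDirection α δ e) :
    ‖conj e‖ ≤ 1 := by simpa using h.norm_le_one

theorem differentiableOn_powExp (γ α x : ℝ) :
    DifferentiableOn ℂ (powExp γ α x) {z | 0 < z.re} :=
  (differentiableOn_cpow_const _).mul (((differentiableOn_cpow_const _).const_mul _).neg.cexp)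

theorem rpow_le_rpow_mul_of_le {γ r R c : ℝ} {p : ℕ} (hr : 0 < r) (hrR : r ≤ R) (hc : 1 ≤ c)
    (hR : R ≤ r * c) (hp : γ ≤ p) : R ^ γ ≤ r ^ γ * c ^ p := by
  rcases le_total 0 γ with h | h
  · calc R ^ γ ≤ (r * c) ^ γ := Real.rpow_le_rpow (hr.le.trans hrR) hR h
      _ = r ^ γ * c ^ γ := Real.mul_rpow hr.le (by linarith)
      _ ≤ r ^ γ * c ^ (p : ℝ) := by gcongr
      _ = _ := by rw [Real.rpow_natCast]
  · calc R ^ γ ≤ r ^ γ * 1 := by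
          rw [mul_one]
          exact Real.rpow_le_rpow_of_nonpos hr hrR h
      _ ≤ _ := by
          gcongr
          exact one_le_pow₀ hc

/-- The bound required by the Abel–Plana formula, for `powExp`. -/
theorem norm_powExp_wedge_le {γ α δ x b u t : ℝ} {e e' : ℂ} (h : IsDampingDirection α δ e)
    (he' : e'.re = e.re) (he1 : ‖e'‖ ≤ 1) (hx : 0 < x) (hb : 0 < b) (hu : 0 ≤ u) (ht : 0 ≤ t) :
    ‖powExp γ α x (b + u + t * e')‖ ≤
      (1 + b⁻¹) ^ ⌈γ⌉₊ * ((b + u + t * e.re) ^ γ *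
        Real.exp (-(x * δ) * (b + u + t * e.re) ^ α)) * (1 + t) ^ ⌈γ⌉₊ := by
  have hre : ((b : ℂ) + u + t * e').re = b + u + t * e.re := by simp [he']
  set z := (b : ℂ) + u + t * e' with hz
  set y := b + u + t * e.re with hy
  have hte : 0 ≤ t * e.re := mul_nonneg ht h.re_nonneg
  have hyb : b ≤ y := by linarith
  have hy0 : 0 < y := hb.trans_le hyb
  have he1' : e.re ≤ 1 := (Complex.re_le_norm e).trans h.norm_le_one
  have hnorm : ‖z‖ ≤ b + u + t := by
    refine (norm_add_le _ _).trans ?_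
    have h1 : ‖(b : ℂ) + u‖ = b + u := by
      rw [← Complex.ofReal_add, Complex.norm_real, Real.norm_of_nonneg (by positivity)]
    have h2 : ‖(t : ℂ) * e'‖ ≤ t := by
      rw [norm_mul, Complex.norm_real, Real.norm_of_nonneg ht]
      nlinarith
    linarith
  have hyz : y ≤ ‖z‖ := hre ▸ Complex.re_le_norm z
  have hsec : e.re * ‖z‖ ≤ z.re := by
    rw [hre]
    have h0 := h.re_nonneg
    calc _ ≤ e.re * (b + u + t) := by gcongr
      _ ≤ y := by
        have : 0 ≤ (1 - e.re) * (b + u) := mul_nonneg (by linarith) (by positivity)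
        simp only [hy]
        nlinarith
  have hdamp := h.le_re_cpow z (hre ▸ hy0) hsec
  rw [hre] at hdamp
  have hz0 : z ≠ 0 := by
    intro h0
    rw [h0, norm_zero] at hyz
    linarith
  have hpow : ‖z ^ (γ : ℂ)‖ = ‖z‖ ^ γ := by
    rw [Complex.norm_cpow_of_ne_zero hz0]
    simp
  have hbi : 0 < b⁻¹ := inv_pos.mpr hb
  have hc : 1 ≤ (1 + b⁻¹) * (1 + t) := by nlinarith [mul_nonneg hbi.le ht]
  have hzy : ‖z‖ ≤ y * ((1 + b⁻¹) * (1 + t)) := by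
    have h1 : 1 ≤ y * b⁻¹ := by
      rw [← div_eq_mul_inv, le_div_iff₀ hb]
      linarith
    have h2 : b + u + t ≤ y + t := by linarith
    have h3 : t ≤ y * b⁻¹ * t := by nlinarith
    have h4 : 0 ≤ y * t := by positivity
    nlinarith [mul_nonneg hy0.le hbi.le]
  have h1 := rpow_le_rpow_mul_of_le hy0 hyz hc hzy (Nat.le_ceil γ)
  have h2 : ‖Complex.exp (-(x * z ^ (α : ℂ)))‖ ≤ Real.exp (-(x * δ) * y ^ α) := by
    rw [Complex.norm_exp, Complex.neg_re, Complex.re_ofReal_mul]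
    refine Real.exp_le_exp.mpr ?_
    nlinarith
  unfold powExp
  rw [norm_mul, hpow]
  calc _ ≤ (y ^ γ * ((1 + b⁻¹) * (1 + t)) ^ ⌈γ⌉₊) * Real.exp (-(x * δ) * y ^ α) := by gcongr
    _ = _ := by rw [mul_pow]; ring

theorem exists_le_of_tendsto_zero {w : ℝ → ℝ} {b : ℝ} (hw : ContinuousOn w (Ici b))
    (h0 : Tendsto w atTop (𝓝 0)) : ∃ C, ∀ y, b ≤ y → w y ≤ C := by
  obtain ⟨Y, hY⟩ := eventually_atTop.mp (h0.eventually_le_const one_pos)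
  obtain ⟨C, hC⟩ := (isCompact_Icc (a := b) (b := Y)).exists_bound_of_continuousOn
    (hw.mono Icc_subset_Ici_self)
  refine ⟨max C 1, fun y hy => ?_⟩
  rcases le_total y Y with h | h
  · exact ((le_abs_self _).trans (hC y ⟨hy, h⟩)).trans (le_max_left _ _)
  · exact (hY y h).trans (le_max_right _ _)

theorem tendsto_powExp_majorant (γ : ℝ) {α δ x b : ℝ} (hα : 0 < α) (hδ : 0 < δ) (hx : 0 < x) :
    Tendsto (fun y : ℝ => (1 + b⁻¹) ^ ⌈γ⌉₊ * (y ^ γ * Real.exp (-(x * δ) * y ^ α))) atTop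
      (𝓝 0) := by
  simpa using (tendsto_rpow_mul_exp_neg_mul_rpow γ hα (mul_pos hx hδ)).const_mul
    ((1 + b⁻¹) ^ ⌈γ⌉₊)

theorem exists_powExp_majorant_le (γ : ℝ) {α δ x b : ℝ} (hα : 0 < α) (hδ : 0 < δ) (hx : 0 < x)
    (hb : 0 < b) : ∃ C, ∀ y, b ≤ y →
      (1 + b⁻¹) ^ ⌈γ⌉₊ * (y ^ γ * Real.exp (-(x * δ) * y ^ α)) ≤ C := by
  refine exists_le_of_tendsto_zero (fun y hy => ?_) (tendsto_powExp_majorant γ hα hδ hx)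
  have hy0 : y ≠ 0 := (hb.trans_le hy).ne'
  exact (((Real.continuousAt_rpow_const _ _ (Or.inl hy0)).mul
    ((Real.continuousAt_rpow_const _ _ (Or.inl hy0)).const_mul _).rexp).const_mul
    _).continuousWithinAt

theorem powExp_ofReal {γ α x t : ℝ} (ht : 0 < t) :
    powExp γ α x t = ((t ^ γ * Real.exp (-x * t ^ α) : ℝ) : ℂ) := by
  unfold powExp
  push_cast
  rw [Complex.ofReal_cpow ht.le, Complex.ofReal_cpow ht.le, neg_mul]

theorem summable_expTerm {a α x : ℝ} (γ : ℝ) (ha : 0 < a) (hα : 0 < α) (hx : 0 < x) :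
    Summable (expTerm a γ α x) := by
  have h1 : Tendsto (fun k : ℕ => (k : ℝ) + a) atTop atTop :=
    tendsto_atTop_add_const_right _ _ tendsto_natCast_atTop_atTop
  have h2 := ((tendsto_rpow_mul_exp_neg_mul_rpow (γ + 2) hα hx).comp h1).eventually_le_const one_pos
  have h3 := (Real.summable_one_div_nat_add_rpow a 2).mpr one_lt_two
  refine summable_of_isBigO_nat h3 (IsBigO.of_bound 1 ?_)
  filter_upwards [h2] with k hk
  have hka : 0 < (k : ℝ) + a := by positivity
  simp only [Function.comp] at hk
  rw [Real.rpow_add hka] at hk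
  rw [one_mul, abs_of_pos hka, Real.norm_of_nonneg (by unfold expTerm; positivity),
    Real.norm_of_nonneg (by positivity), le_div_iff₀ (by positivity)]
  unfold expTerm
  rw [show -((k : ℝ) + a) ^ α * x = -x * ((k : ℝ) + a) ^ α by ring]
  linarith

/-- The Abel–Plana formula for the series. -/
theorem expSeries_eq {a γ α δ x : ℝ} {e : ℂ} (h : IsDampingDirection α δ e) (ha : 0 < a)
    (hα : 0 < α) (hx : 0 < x) :
    (expSeries a γ α x : ℂ) = ((a ^ γ * Real.exp (-x * a ^ α) : ℝ) : ℂ) +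
      incompleteIntegral γ α x (a + 1 / 2) - rayIntegral e (powExp γ α x) (a + 1 / 2) := by
  set b := a + 1 / 2 with hbdef
  have hb : 0 < b := by positivity
  have hs := (summable_expTerm γ ha hα hx).hasSum
  have h1 := (hasSum_nat_add_iff' 1).mpr hs
  have h2 : HasSum (fun k : ℕ => powExp γ α x (b + 1 / 2 + k))
      ((∑' k, expTerm a γ α x k - ∑ k ∈ Finset.range 1, expTerm a γ α x k : ℝ) : ℂ) := by
    have := (Complex.hasSum_ofReal).mpr h1
    refine this.congr_fun fun k => ?_
    have e1 : (b : ℂ) + 1 / 2 + k = (((k + 1 : ℕ) + a : ℝ) : ℂ) := by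
      rw [hbdef]; push_cast; ring
    rw [e1, powExp_ofReal (by positivity)]
    unfold expTerm
    rw [show -x * (((k + 1 : ℕ) : ℝ) + a) ^ α = -(((k + 1 : ℕ) : ℝ) + a) ^ α * x by ring]
  obtain ⟨C, hC⟩ := exists_powExp_majorant_le γ hα h.pos hx hb
  have hint : ∀ t ∈ Ioi b, powExp γ α x t = ((t ^ γ * Real.exp (-x * t ^ α) : ℝ) : ℂ) :=
    fun t ht => powExp_ofReal (hb.trans ht)
  have hI : IntegrableOn (fun t : ℝ => ((t ^ γ * Real.exp (-x * t ^ α) : ℝ) : ℂ)) (Ioi b) :=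
    (integrableOn_rpow_mul_exp_neg_Ioi γ hα hx hb).ofReal
  have h3 := abelPlana_hasSum hb h.re_nonneg h.im_pos (differentiableOn_powExp γ α x) hC
    (tendsto_powExp_majorant γ hα h.pos hx)
    (fun u t hu ht => norm_powExp_wedge_le h rfl h.norm_le_one hx hb hu ht)
    (fun u t hu ht => norm_powExp_wedge_le h (Complex.conj_re e) h.norm_conj_le_one hx hb hu ht)
    h2 (hI.congr_fun (fun t ht => (hint t ht).symm) measurableSet_Ioi)
  rw [setIntegral_congr_fun measurableSet_Ioi hint, integral_complex_ofReal] at h3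
  have h4 : ∑ k ∈ Finset.range 1, expTerm a γ α x k = a ^ γ * Real.exp (-x * a ^ α) := by
    simp [expTerm, mul_comm]
  rw [h4] at h3
  unfold expSeries incompleteIntegral
  push_cast at h3 ⊢
  linear_combination h3

/-! ### Expansion of the correction term -/

/-- The Taylor remainder of `exp (-w)` is `O(‖w‖ ^ N)` on the whole closed right half-plane. -/
theorem exists_norm_exp_neg_sub_sum_le (N : ℕ) : ∃ C : ℝ, 0 ≤ C ∧ ∀ w : ℂ, 0 ≤ w.re →
    ‖Complex.exp (-w) - ∑ k ∈ Finset.range N, (-w) ^ k / k.factorial‖ ≤ C * ‖w‖ ^ N := by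
  refine ⟨Real.exp 1 + 1 + N, by positivity, fun w hw => ?_⟩
  rcases le_total ‖w‖ 1 with h | h
  · refine (Complex.norm_exp_sub_sum_le_norm_mul_exp (-w) N).trans ?_
    rw [norm_neg, mul_comm]
    have : Real.exp ‖w‖ ≤ Real.exp 1 := Real.exp_le_exp.mpr h
    have : (0 : ℝ) ≤ N := N.cast_nonneg
    gcongr
    linarith
  · have h1 : ‖Complex.exp (-w)‖ ≤ ‖w‖ ^ N := by
      rw [Complex.norm_exp, Complex.neg_re]
      exact (Real.exp_le_one_iff.mpr (by linarith)).trans (one_le_pow₀ h)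
    have h2 : ‖∑ k ∈ Finset.range N, (-w) ^ k / k.factorial‖ ≤ N * ‖w‖ ^ N := by
      refine (norm_sum_le _ _).trans ?_
      have : ∀ k ∈ Finset.range N, ‖(-w) ^ k / (k.factorial : ℂ)‖ ≤ ‖w‖ ^ N := by
        intro k hk
        rw [norm_div, norm_pow, norm_neg, Complex.norm_natCast]
        have hf : (1 : ℝ) ≤ k.factorial := by exact_mod_cast k.factorial_pos
        calc _ ≤ ‖w‖ ^ k := div_le_self (by positivity) hf
          _ ≤ _ := pow_le_pow_right₀ h (Finset.mem_range.mp hk).le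
      simpa using Finset.sum_le_sum this
    refine (norm_sub_le _ _).trans ?_
    have : 0 ≤ Real.exp 1 * ‖w‖ ^ N := by positivity
    nlinarith

theorem cpow_mul_pow_cpow {z : ℂ} (hz : z ≠ 0) (γ α x : ℝ) (k : ℕ) :
    z ^ (γ : ℂ) * ((-(x * z ^ (α : ℂ))) ^ k / k.factorial) =
      (-x : ℂ) ^ k / k.factorial * z ^ ((γ + α * k : ℝ) : ℂ) := by
  push_cast
  rw [Complex.cpow_add _ _ hz, mul_comm (α : ℂ), Complex.cpow_nat_mul, neg_mul_eq_neg_mul, mul_pow]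
  ring

theorem IsDampingDirection.re_cpow_ray_nonneg {α δ b t : ℝ} {e e' : ℂ}
    (h : IsDampingDirection α δ e) (he' : e'.re = e.re) (he1 : ‖e'‖ ≤ 1) (hb : 0 < b)
    (ht : 0 ≤ t) : 0 ≤ (((b : ℂ) + t * e') ^ (α : ℂ)).re := by
  have h0 : 0 ≤ e'.re := he' ▸ h.re_nonneg
  have h1 : e'.re ≤ 1 := (Complex.re_le_norm e').trans he1
  have hre : ((b : ℂ) + t * e').re = b + t * e'.re := by simp
  have hz := (ray_bounds ht hb h0 he1).1
  have hn := (ray_bounds ht hb h0 he1).2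
  refine le_trans ?_ (h.le_re_cpow _ (hb.trans_le hz) ?_)
  · have := h.pos
    have : 0 < ((b : ℂ) + t * e').re := hb.trans_le hz
    positivity
  · rw [hre, ← he']
    calc _ ≤ e'.re * (b + t) := by gcongr
      _ ≤ _ := by nlinarith

theorem ray_ne_zero {b t : ℝ} {e : ℂ} (hb : 0 < b) (he0 : 0 ≤ e.re) (ht : 0 ≤ t) :
    (b : ℂ) + t * e ≠ 0 := fun h => by
  have := re_pos_of_ray hb he0 ht
  rw [h] at this
  simp at this

/-- Taylor remainder of `powExp` on a ray, as a function of `x`. -/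
theorem exists_norm_powExp_sub_sum_le {α δ b : ℝ} {e : ℂ} (γ : ℝ) (h : IsDampingDirection α δ e)
    (hb : 0 < b) (N : ℕ) : ∃ (C : ℝ) (p : ℕ), 0 ≤ C ∧ ∀ e' : ℂ, e'.re = e.re → ‖e'‖ ≤ 1 →
      ∀ x t : ℝ, 0 < x → 0 ≤ t →
      ‖powExp γ α x (b + t * e') - ∑ k ∈ Finset.range N,
        (-x : ℂ) ^ k / k.factorial * (b + t * e') ^ ((γ + α * k : ℝ) : ℂ)‖ ≤
        x ^ N * (C * (1 + t) ^ p) := by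
  obtain ⟨C, hC0, hC⟩ := exists_norm_exp_neg_sub_sum_le N
  set s : ℂ := ((γ + α * N : ℝ) : ℂ)
  refine ⟨C * ((1 + b + b⁻¹) * Real.exp Real.pi) ^ ⌈‖s‖⌉₊, ⌈‖s‖⌉₊, by positivity,
    fun e' he' he1 x t hx ht => ?_⟩
  have h0 : 0 ≤ e'.re := he' ▸ h.re_nonneg
  have hz := ray_ne_zero hb h0 ht
  have hb1 := norm_cpow_ray_le ht hb h0 he1 s
  have hre := h.re_cpow_ray_nonneg he' he1 hb ht
  set z := (b : ℂ) + t * e'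
  have hw : 0 ≤ ((x : ℂ) * z ^ (α : ℂ)).re := by
    rw [Complex.re_ofReal_mul]
    positivity
  have e1 : powExp γ α x z - ∑ k ∈ Finset.range N,
        (-x : ℂ) ^ k / k.factorial * z ^ ((γ + α * k : ℝ) : ℂ) =
      z ^ (γ : ℂ) * (Complex.exp (-(x * z ^ (α : ℂ))) -
        ∑ k ∈ Finset.range N, (-(x * z ^ (α : ℂ))) ^ k / k.factorial) := by
    rw [mul_sub, Finset.mul_sum]
    simp_rw [cpow_mul_pow_cpow hz]
    rfl
  have e2 : ‖z ^ (γ : ℂ)‖ * ‖(x : ℂ) * z ^ (α : ℂ)‖ ^ N = x ^ N * ‖z ^ s‖ := by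
    rw [norm_mul, mul_pow, Complex.norm_real, Real.norm_of_nonneg hx.le]
    have : z ^ s = z ^ (γ : ℂ) * (z ^ (α : ℂ)) ^ N := by
      simp only [s]
      push_cast
      rw [Complex.cpow_add _ _ hz, mul_comm (α : ℂ), Complex.cpow_nat_mul]
    rw [this, norm_mul, norm_pow]
    ring
  rw [e1, norm_mul]
  calc _ ≤ ‖z ^ (γ : ℂ)‖ * (C * ‖(x : ℂ) * z ^ (α : ℂ)‖ ^ N) := by gcongr; exact hC _ hw
    _ = C * (‖z ^ (γ : ℂ)‖ * ‖(x : ℂ) * z ^ (α : ℂ)‖ ^ N) := by ring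
    _ = x ^ N * (C * ‖z ^ s‖) := by rw [e2]; ring
    _ ≤ x ^ N * (C * (((1 + b + b⁻¹) * Real.exp Real.pi) ^ ⌈‖s‖⌉₊ * (1 + t) ^ ⌈‖s‖⌉₊)) := by
      gcongr
    _ = _ := by ring

theorem exists_norm_mul_midpointKernel_le {e : ℂ} (he : 0 < e.im) (he1 : ‖e‖ ≤ 1) :
    ∃ M : ℝ, 0 < M ∧ ∀ t : ℝ, 0 ≤ t →
      ‖e * midpointKernel (t * e)‖ ≤ M * Real.exp (-(2 * Real.pi * e.im * t)) := by
  obtain ⟨M, hM0, hM⟩ := exists_norm_midpointKernel_ray_le he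
  refine ⟨M, hM0, fun t ht => ?_⟩
  rw [norm_mul]
  calc _ ≤ 1 * (M * Real.exp (-(2 * Real.pi * e.im * t))) := by
        gcongr
        exact hM t ht
    _ = _ := one_mul _

theorem integrableOn_rayIntegrand_cpow {b : ℝ} {e : ℂ} (hb : 0 < b) (he0 : 0 ≤ e.re)
    (he : 0 < e.im) (he1 : ‖e‖ ≤ 1) (s : ℂ) :
    IntegrableOn (rayIntegrand e (fun z => z ^ s) b) (Ioi 0) :=
  integrableOn_rayIntegrand hb he0 he (differentiableOn_cpow_const s)
    (fun _ ht => norm_cpow_ray_le ht hb he0 he1 s)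
    (fun _ ht => norm_cpow_ray_le ht hb (by simpa using he0) (by simpa using he1) s)

theorem integrableOn_rayIntegrand_powExp {γ α δ x b : ℝ} {e : ℂ} (h : IsDampingDirection α δ e)
    (hα : 0 < α) (hx : 0 < x) (hb : 0 < b) :
    IntegrableOn (rayIntegrand e (powExp γ α x) b) (Ioi 0) := by
  obtain ⟨C, hC⟩ := exists_powExp_majorant_le γ hα h.pos hx hb
  have key : ∀ e' : ℂ, e'.re = e.re → ‖e'‖ ≤ 1 → ∀ t : ℝ, 0 ≤ t →
      ‖powExp γ α x (b + t * e')‖ ≤ C * (1 + t) ^ ⌈γ⌉₊ := by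
    intro e' he' he1 t ht
    have h1 := norm_powExp_wedge_le (γ := γ) h he' he1 hx hb le_rfl ht
    have h2 := hC (b + 0 + t * e.re) (by
      have := mul_nonneg ht h.re_nonneg
      linarith)
    have h3 := h1.trans (mul_le_mul_of_nonneg_right h2 (by positivity : 0 ≤ (1 + t) ^ ⌈γ⌉₊))
    simpa using h3
  exact integrableOn_rayIntegrand hb h.re_nonneg h.im_pos (differentiableOn_powExp γ α x)
    (key e rfl h.norm_le_one) (key _ (Complex.conj_re e) h.norm_conj_le_one)

/-- The correction term of the series has an asymptotic expansion at `x = 0`. -/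
theorem rayIntegral_powExp_isBigO {α δ b : ℝ} {e : ℂ} (γ : ℝ) (h : IsDampingDirection α δ e)
    (hα : 0 < α) (hb : 0 < b) (N : ℕ) :
    (fun x : ℝ => rayIntegral e (powExp γ α x) b - ∑ k ∈ Finset.range N,
      (-x : ℂ) ^ k / k.factorial * rayIntegral e (fun z => z ^ ((γ + α * k : ℝ) : ℂ)) b)
      =O[𝓝[>] (0 : ℝ)] fun x : ℝ => x ^ N := by
  obtain ⟨C, p, hC0, hC⟩ := exists_norm_powExp_sub_sum_le γ h hb N
  obtain ⟨M, hM0, hM⟩ := exists_norm_mul_midpointKernel_le h.im_pos h.norm_le_one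
  have hbd := (integrableOn_one_add_pow_mul_exp_neg p
    (by have := h.im_pos; positivity : 0 < 2 * Real.pi * e.im)).const_mul (2 * M * C)
  refine IsBigO.of_bound (∫ t in Ioi (0 : ℝ),
    2 * M * C * ((1 + t) ^ p * Real.exp (-(2 * Real.pi * e.im * t)))) ?_
  filter_upwards [self_mem_nhdsWithin] with x hx
  have hx0 : 0 < x := hx
  have hi := fun k : ℕ => (integrableOn_rayIntegrand_cpow hb h.re_nonneg h.im_pos h.norm_le_one
    ((γ + α * k : ℝ) : ℂ)).const_mul ((-x : ℂ) ^ k / k.factorial)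
  have e1 : rayIntegral e (powExp γ α x) b - ∑ k ∈ Finset.range N,
      (-x : ℂ) ^ k / k.factorial * rayIntegral e (fun z => z ^ ((γ + α * k : ℝ) : ℂ)) b =
      ∫ t in Ioi (0 : ℝ), rayIntegrand e (fun z => powExp γ α x z - ∑ k ∈ Finset.range N,
        (-x : ℂ) ^ k / k.factorial * z ^ ((γ + α * k : ℝ) : ℂ)) b t := by
    unfold rayIntegral
    simp_rw [← integral_const_mul]
    rw [← integral_finsetSum _ fun k _ => hi k, ← integral_sub
      (integrableOn_rayIntegrand_powExp h hα hx0 hb) (integrable_finsetSum _ fun k _ => hi k)]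
    congr 1
    funext t
    simp only [rayIntegrand, mul_sub, Finset.mul_sum, mul_add, Finset.sum_add_distrib]
    rw [add_sub_add_comm]
    congr 2 <;> exact Finset.sum_congr rfl fun k _ => by ring
  rw [e1, norm_pow, Real.norm_of_nonneg hx0.le, mul_comm, ← integral_const_mul]
  refine norm_integral_le_of_norm_le (hbd.const_mul (x ^ N)) ?_
  refine (ae_restrict_iff' measurableSet_Ioi).mpr (ae_of_all _ fun t ht => ?_)
  have ht0 : 0 ≤ t := le_of_lt ht
  refine (norm_rayIntegrand_le (hM t ht0) (hC e rfl h.norm_le_one x t hx0 ht0)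
    (hC _ (Complex.conj_re e) h.norm_conj_le_one x t hx0 ht0)).trans_eq ?_
  ring

theorem exists_mul_rpow_le {α x : ℝ} (hα : 0 < α) (hα1 : α ≤ 1) (hx : 0 < x)
    (h2π : α = 1 → x < 2 * Real.pi) :
    ∃ C μ : ℝ, 0 ≤ μ ∧ μ < 2 * Real.pi ∧ ∀ y : ℝ, 0 ≤ y → x * y ^ α ≤ C + μ * y := by
  rcases hα1.eq_or_lt with rfl | h
  · exact ⟨0, x, hx.le, h2π rfl, fun y _ => by simp⟩
  · -- for `y ≥ L` the power is dominated by the linear term with slope `1`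
    set L := x ^ (1 - α)⁻¹
    have hL : 0 < L := by positivity
    have h1α : 0 < 1 - α := by linarith
    have hxL : x = L ^ (1 - α) := by
      simp only [L]
      rw [← Real.rpow_mul hx.le, inv_mul_cancel₀ h1α.ne', Real.rpow_one]
    refine ⟨x * L ^ α, 1, zero_le_one, by linarith [Real.pi_gt_three], fun y hy => ?_⟩
    rcases le_total y L with hyL | hyL
    · have : x * y ^ α ≤ x * L ^ α := by gcongr
      linarith
    · have hy0 : 0 < y := hL.trans_le hyL
      have h1 : L ^ (1 - α) ≤ y ^ (1 - α) := Real.rpow_le_rpow hL.le hyL h1α.le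
      have h2 : y ^ (1 - α) * y ^ α = y := by
        rw [← Real.rpow_add hy0]; simp
      have h3 : x * y ^ α ≤ y := by
        calc x * y ^ α ≤ y ^ (1 - α) * y ^ α := by rw [hxL]; gcongr
          _ = y := h2
      have : 0 ≤ x * L ^ α := by positivity
      linarith

/-- For `α ≤ 1` the expansion of the correction term converges.  On the vertical line through `b`
the series of absolute values is `‖z‖ ^ γ * exp (x ‖z‖ ^ α)`, which the kernel `exp (-2πt)`
dominates if `α < 1`, or if `α = 1` and `x < 2π`. -/
theorem hasSum_rayIntegral_powExp {α x b : ℝ} (γ : ℝ) (hα : 0 < α) (hα1 : α ≤ 1) (hx : 0 < x)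
    (hb : 0 < b) (h2π : α = 1 → x < 2 * Real.pi) :
    HasSum (fun k : ℕ => (-x : ℂ) ^ k / k.factorial *
      rayIntegral Complex.I (fun z => z ^ ((γ + α * k : ℝ) : ℂ)) b)
      (rayIntegral Complex.I (powExp γ α x) b) := by
  have he0 : 0 ≤ Complex.I.re := by simp
  have he : 0 < Complex.I.im := by simp
  have he1 : ‖Complex.I‖ ≤ 1 := by simp
  obtain ⟨M, hM0, hM⟩ := exists_norm_mul_midpointKernel_le he he1
  obtain ⟨C, μ, hμ0, hμ, hC⟩ := exists_mul_rpow_le hα hα1 hx h2π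
  set A := ((1 + b + b⁻¹) * Real.exp Real.pi) ^ ⌈‖(γ : ℂ)‖⌉₊
  set p := ⌈‖(γ : ℂ)‖⌉₊
  set ρ : ℝ → ℝ := fun t => ‖(b : ℂ) + t * Complex.I‖
  have hρ0 : ∀ t, 0 ≤ ρ t := fun t => norm_nonneg _
  have hρconj : ∀ t : ℝ, ‖(b : ℂ) + t * conj Complex.I‖ = ρ t := by
    intro t
    rw [← Complex.norm_conj]
    simp [ρ]
  have hρle : ∀ t : ℝ, 0 ≤ t → ρ t ≤ b + t := fun t ht => (ray_bounds ht hb he0 he1).2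
  set E : ℝ → ℝ := fun t => Real.exp (-(2 * Real.pi * Complex.I.im * t))
  set bd : ℕ → ℝ → ℝ := fun k t =>
    2 * (M * E t * (A * (1 + t) ^ p * ((x * ρ t ^ α) ^ k / k.factorial)))
  have hbdsum : ∀ t, HasSum (fun k => bd k t)
      (2 * (M * E t * (A * (1 + t) ^ p * Real.exp (x * ρ t ^ α)))) := by
    intro t
    have := NormedSpace.expSeries_div_hasSum_exp (x * ρ t ^ α)
    rw [← Real.exp_eq_exp_ℝ] at this
    exact ((this.mul_left _).mul_left _).mul_left _
  have hterm : ∀ e' : ℂ, 0 ≤ e'.re → ‖e'‖ ≤ 1 → ∀ t : ℝ, 0 ≤ t → ‖(b : ℂ) + t * e'‖ = ρ t →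
      ∀ k : ℕ, ‖(-x : ℂ) ^ k / k.factorial * ((b : ℂ) + t * e') ^ ((γ + α * k : ℝ) : ℂ)‖ ≤
        A * (1 + t) ^ p * ((x * ρ t ^ α) ^ k / k.factorial) := by
    intro e' h0 h1 t ht hn k
    have hz := ray_ne_zero hb h0 ht
    rw [← cpow_mul_pow_cpow hz, norm_mul, norm_div, norm_pow, norm_neg, norm_mul,
      Complex.norm_natCast, Complex.norm_real, Real.norm_of_nonneg hx.le]
    have h3 : ‖((b : ℂ) + t * e') ^ (α : ℂ)‖ = ρ t ^ α := by
      rw [Complex.norm_cpow_of_ne_zero hz, hn]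
      simp
    rw [h3]
    have := norm_cpow_ray_le ht hb h0 h1 (γ : ℂ)
    have hr := hρ0 t
    gcongr
  have hcont : Continuous fun t => 2 * (M * E t * (A * (1 + t) ^ p * Real.exp (x * ρ t ^ α))) := by
    have hρc : Continuous ρ := by fun_prop
    have : Continuous fun t => ρ t ^ α := hρc.rpow_const fun t => Or.inr hα.le
    fun_prop
  have hfun : (fun k : ℕ => (-x : ℂ) ^ k / k.factorial *
      rayIntegral Complex.I (fun z => z ^ ((γ + α * k : ℝ) : ℂ)) b) =
      fun k : ℕ => ∫ t in Ioi (0 : ℝ), rayIntegrand Complex.I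
        (fun z => (-x : ℂ) ^ k / k.factorial * z ^ ((γ + α * k : ℝ) : ℂ)) b t := by
    funext k
    unfold rayIntegral
    rw [← integral_const_mul]
    congr 1
    funext t
    unfold rayIntegrand
    ring
  rw [hfun]
  refine hasSum_integral_of_dominated_convergence (μ := volume.restrict (Ioi 0)) bd ?_ ?_ ?_ ?_ ?_
  · intro k
    have := (integrableOn_rayIntegrand_cpow hb he0 he he1 ((γ + α * k : ℝ) : ℂ)).const_mul
      ((-x : ℂ) ^ k / k.factorial)
    refine this.aestronglyMeasurable.congr (ae_of_all _ fun t => ?_)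
    simp only [rayIntegrand]
    ring
  · intro k
    refine (ae_restrict_iff' measurableSet_Ioi).mpr (ae_of_all _ fun t ht => ?_)
    have ht0 : 0 ≤ t := le_of_lt ht
    exact norm_rayIntegrand_le (hM t ht0) (hterm _ he0 he1 t ht0 rfl k)
      (hterm _ (by simp) (by simp) t ht0 (hρconj t) k)
  · exact ae_of_all _ fun t => (hbdsum t).summable
  · simp_rw [fun t => (hbdsum t).tsum_eq]
    have hη : 0 < 2 * Real.pi - μ := by linarith
    refine ((integrableOn_one_add_pow_mul_exp_neg p hη).const_mul
      (2 * M * A * Real.exp (C + μ * b))).mono' hcont.aestronglyMeasurable ?_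
    refine (ae_restrict_iff' measurableSet_Ioi).mpr (ae_of_all _ fun t ht => ?_)
    have ht0 : 0 ≤ t := le_of_lt ht
    have hA : 0 ≤ A := by positivity
    rw [Real.norm_of_nonneg (by positivity)]
    have h1 : Real.exp (x * ρ t ^ α) ≤ Real.exp (C + μ * (b + t)) := by
      refine Real.exp_le_exp.mpr ((hC _ (hρ0 t)).trans ?_)
      have := hρle t ht0
      gcongr
    have h2 : E t * Real.exp (C + μ * (b + t)) =
        Real.exp (C + μ * b) * Real.exp (-((2 * Real.pi - μ) * t)) := by
      simp only [E]
      rw [← Real.exp_add, ← Real.exp_add, Complex.I_im]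
      ring_nf
    calc _ ≤ 2 * (M * E t * (A * (1 + t) ^ p * Real.exp (C + μ * (b + t)))) := by gcongr
      _ = 2 * M * A * (1 + t) ^ p * (E t * Real.exp (C + μ * (b + t))) := by ring
      _ = _ := by rw [h2]; ring
  · refine (ae_restrict_iff' measurableSet_Ioi).mpr (ae_of_all _ fun t ht => ?_)
    have ht0 : 0 ≤ t := le_of_lt ht
    have hpt : ∀ z : ℂ, z ≠ 0 → HasSum (fun k : ℕ =>
        (-x : ℂ) ^ k / k.factorial * z ^ ((γ + α * k : ℝ) : ℂ)) (powExp γ α x z) := by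
      intro z hz
      have := (NormedSpace.expSeries_div_hasSum_exp (-((x : ℂ) * z ^ (α : ℂ)))).mul_left
        (z ^ (γ : ℂ))
      rw [← Complex.exp_eq_exp_ℂ] at this
      simp_rw [cpow_mul_pow_cpow hz] at this
      exact this
    exact ((hpt _ (ray_ne_zero hb he0 ht0)).mul_left _).add
      ((hpt _ (ray_ne_zero hb (by simp) ht0)).mul_left _)

/-! ### The expansion of the series -/

/-- The sum of the three contributions to the `k`-th term of the expansion, with
`b = a + 1/2`: those of the first summand, of the integral, and of the correction term. -/
noncomputable def expansionTerm (e : ℂ) (a γ α x : ℝ) (k : ℕ) : ℂ :=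
  (((-x) ^ k / k.factorial * a ^ (γ + α * k) : ℝ) : ℂ) -
    incompleteTerm γ α x (a + 1 / 2) k -
    (-x : ℂ) ^ k / k.factorial * rayIntegral e (fun z => z ^ ((γ + α * k : ℝ) : ℂ)) (a + 1 / 2)

/-- An everywhere convergent power series is its own asymptotic expansion at `0`. -/
theorem isBigO_sub_sum_of_hasSum {S : ℝ → ℝ} {c : ℕ → ℝ}
    (h : ∀ x : ℝ, 0 < x → HasSum (fun k => c k * x ^ k) (S x)) (N : ℕ) :
    (fun x => S x - ∑ k ∈ Finset.range N, c k * x ^ k) =O[𝓝[>] (0 : ℝ)] fun x : ℝ => x ^ N := by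
  have hc : Summable fun k => ‖c k‖ := by
    have := (h 1 one_pos).summable.norm
    simpa using this
  refine IsBigO.of_bound (∑' k, ‖c (k + N)‖) ?_
  filter_upwards [Ioo_mem_nhdsGT (zero_lt_one' ℝ)] with x hx
  have hx0 := hx.1
  have h1 := (hasSum_nat_add_iff' N).mpr (h x hx0)
  have h2 := ((summable_nat_add_iff N).mpr hc).hasSum.mul_right (x ^ N)
  rw [Real.norm_of_nonneg (by positivity : 0 ≤ x ^ N), ← h1.tsum_eq]
  refine tsum_of_norm_bounded h2 fun k => ?_
  rw [norm_mul, pow_add, norm_mul, norm_pow, Real.norm_of_nonneg hx0.le, norm_pow,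
    Real.norm_of_nonneg hx0.le]
  have : x ^ k ≤ 1 := pow_le_one₀ hx0.le hx.2.le
  calc _ ≤ ‖c (k + N)‖ * (1 * x ^ N) := by gcongr
    _ = _ := by rw [one_mul]

theorem expSeries_sub_isBigO {a γ α δ : ℝ} {e : ℂ} (h : IsDampingDirection α δ e) (ha : 0 < a)
    (hα : 0 < α) {G : ℝ → ℝ}
    (hG : ∀ x : ℝ, 0 < x → HasSum (incompleteTerm γ α x (a + 1 / 2))
      (G x - incompleteIntegral γ α x (a + 1 / 2))) (N : ℕ) :
    (fun x : ℝ => (expSeries a γ α x : ℂ) -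
      ((G x : ℂ) + ∑ k ∈ Finset.range N, expansionTerm e a γ α x k))
      =O[𝓝[>] (0 : ℝ)] fun x : ℝ => x ^ N := by
  have h1 := isBigO_sub_sum_of_hasSum (S := fun x => a ^ γ * Real.exp (-x * a ^ α))
    (c := fun k => (-1) ^ k / k.factorial * a ^ (γ + α * k)) (fun x _ => by
      refine (hasSum_exp_neg_mul_rpow ha γ α x).congr_fun fun k => ?_
      rw [neg_pow x]; ring) N
  have h2 := isBigO_sub_sum_of_hasSum
    (c := fun k => (-1) ^ k / k.factorial *
      ((a + 1 / 2) ^ (γ + α * k + 1) / (γ + α * k + 1))) (fun x hx => by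
      refine (hG x hx).congr_fun fun k => ?_
      unfold incompleteTerm
      rw [neg_pow x]; ring) N
  have h3 := rayIntegral_powExp_isBigO γ h hα (by positivity : 0 < a + 1 / 2) N
  have h1' := (isBigO_norm_left.mpr h1).congr_left (f₂ := fun x =>
    ‖(((a ^ γ * Real.exp (-x * a ^ α) -
      ∑ k ∈ Finset.range N, (-1) ^ k / k.factorial * a ^ (γ + α * k) * x ^ k : ℝ)) : ℂ)‖)
    fun x => (Complex.norm_real _).symm
  have h2' := (isBigO_norm_left.mpr h2).congr_left (f₂ := fun x =>
    ‖((G x - incompleteIntegral γ α x (a + 1 / 2) - ∑ k ∈ Finset.range N, (-1) ^ k / k.factorial *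
      ((a + 1 / 2) ^ (γ + α * k + 1) / (γ + α * k + 1)) * x ^ k : ℝ) : ℂ)‖)
    fun x => (Complex.norm_real _).symm
  refine (((isBigO_norm_left.mp h1').sub (isBigO_norm_left.mp h2')).sub h3).congr' ?_
    EventuallyEq.rfl
  filter_upwards [self_mem_nhdsWithin] with x hx
  rw [expSeries_eq h ha hα hx]
  have e1 : ∑ k ∈ Finset.range N, expansionTerm e a γ α x k =
      ((∑ k ∈ Finset.range N, (-1) ^ k / k.factorial * a ^ (γ + α * k) * x ^ k : ℝ) : ℂ) -
      ((∑ k ∈ Finset.range N, (-1) ^ k / k.factorial *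
        ((a + 1 / 2) ^ (γ + α * k + 1) / (γ + α * k + 1)) * x ^ k : ℝ) : ℂ) -
      ∑ k ∈ Finset.range N, (-x : ℂ) ^ k / k.factorial *
        rayIntegral e (fun z => z ^ ((γ + α * k : ℝ) : ℂ)) (a + 1 / 2) := by
    rw [Complex.ofReal_sum, Complex.ofReal_sum, ← Finset.sum_sub_distrib, ← Finset.sum_sub_distrib]
    refine Finset.sum_congr rfl fun k _ => ?_
    unfold expansionTerm incompleteTerm
    rw [neg_pow x]
    push_cast
    ring
  rw [e1]
  simp only [Complex.ofReal_sub]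
  ring

theorem hasSum_expansionTerm {a γ α x : ℝ} (ha : 0 < a) (hα : 0 < α) (hα1 : α ≤ 1) (hx : 0 < x)
    (h2π : α = 1 → x < 2 * Real.pi) {G : ℝ}
    (hG : HasSum (incompleteTerm γ α x (a + 1 / 2))
      (G - incompleteIntegral γ α x (a + 1 / 2))) :
    HasSum (expansionTerm Complex.I a γ α x) ((expSeries a γ α x - G : ℝ) : ℂ) := by
  obtain ⟨δ, h⟩ := exists_isDampingDirection_I hα hα1
  have h1 := Complex.hasSum_ofReal.mpr (hasSum_exp_neg_mul_rpow ha γ α x)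
  have h2 := Complex.hasSum_ofReal.mpr hG
  have h3 := hasSum_rayIntegral_powExp γ hα hα1 hx (by positivity : 0 < a + 1 / 2) h2π
  have h4 := (h1.sub h2).sub h3
  have h5 : ((expSeries a γ α x - G : ℝ) : ℂ) = ((a ^ γ * Real.exp (-x * a ^ α) : ℝ) : ℂ) -
      ((G - incompleteIntegral γ α x (a + 1 / 2) : ℝ) : ℂ) -
      rayIntegral Complex.I (powExp γ α x) (a + 1 / 2) := by
    rw [Complex.ofReal_sub, expSeries_eq h ha hα hx]
    push_cast
    ring
  rw [h5]
  exact h4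

/-- Hermite's formula, read as the identification of the coefficients. -/
theorem expansionTerm_eq_zetaTerm {a γ α : ℝ} {e : ℂ} (ha : 0 < a) (he0 : 0 ≤ e.re) (he : 0 < e.im)
    (he1 : ‖e‖ ≤ 1) (x : ℝ) {k : ℕ} (hk : γ + α * k + 1 ≠ 0) :
    expansionTerm e a γ α x k = zetaTerm a γ α x k := by
  have hb : 0 < a + 1 / 2 := by positivity
  have hs : ((-α * k - γ : ℝ) : ℂ) ≠ 1 := by
    intro h
    have h' : -α * k - γ = 1 := by exact_mod_cast h
    exact hk (by linarith)
  have e1 : -((-α * k - γ : ℝ) : ℂ) = ((γ + α * k : ℝ) : ℂ) := by push_cast; ring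
  have e2 : 1 - ((-α * k - γ : ℝ) : ℂ) = ((γ + α * k + 1 : ℝ) : ℂ) := by push_cast; ring
  have e3 : ((-α * k - γ : ℝ) : ℂ) - 1 = -((γ + α * k + 1 : ℝ) : ℂ) := by push_cast; ring
  unfold zetaTerm expansionTerm incompleteTerm
  rw [hurwitzZetaPos_eq ha he0 he he1 hs, e1, e2, e3, ← Complex.ofReal_cpow ha.le,
    ← Complex.ofReal_cpow hb.le, neg_pow (x : ℂ), neg_pow x]
  push_cast
  rw [div_neg]
  ring

/-- At the index where the zeta term would be at the pole, the vanishing denominator in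
`incompleteTerm` contributes `0`, and what remains is a multiple of `x ^ r`. -/
theorem expansionTerm_of_eq {a γ α : ℝ} {e : ℂ} (ha : 0 < a) (he0 : 0 ≤ e.re) (he : 0 < e.im)
    (x : ℝ) {r : ℕ} (hr : γ + α * r + 1 = 0) :
    expansionTerm e a γ α x r = (((-1) ^ r * x ^ r / Real.Gamma (r + 1) *
      (Real.log (a + 1 / 2) - deriv Real.Gamma a / Real.Gamma a) : ℝ) : ℂ) := by
  have h1 : γ + α * r = -1 := by linarith
  unfold expansionTerm incompleteTerm
  rw [hr, h1]
  have e1 := rayIntegral_cpow_neg_one (e := e) ha he0 he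
  rw [Complex.ofReal_neg, Complex.ofReal_one, e1, Real.Gamma_nat_eq_factorial, Real.rpow_neg_one,
    neg_pow (x : ℂ), neg_pow x]
  push_cast
  rw [div_zero]
  ring

theorem add_one_ne_zero_of_ne {γ α : ℝ} (hα : 0 < α) {k : ℕ} (h : -((γ + 1) / α) ≠ (k : ℝ)) :
    γ + α * k + 1 ≠ 0 := by
  intro h0
  apply h
  rw [← neg_div, div_eq_iff hα.ne']
  linarith

theorem hasExpansionAtZero_gammaTerm {a γ α : ℝ} (ha : 0 < a) (hα : 0 < α)
    (hγ : ∀ r : ℕ, -((γ + 1) / α) ≠ (r : ℝ)) :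
    HasExpansionAtZero (expSeries a γ α) (gammaTerm γ α) (zetaTerm a γ α) := by
  obtain ⟨e, δ, h⟩ := exists_isDampingDirection hα
  intro N
  refine (expSeries_sub_isBigO h ha hα
    (fun x hx => hasSum_incompleteTerm_of_ne hα hx (by positivity) hγ) N).congr_left fun x => ?_
  rw [Finset.sum_congr rfl fun k _ => expansionTerm_eq_zetaTerm ha h.re_nonneg h.im_pos
    h.norm_le_one x (add_one_ne_zero_of_ne hα (hγ k))]

theorem hasSum_zetaTerm {a γ α x : ℝ} (ha : 0 < a) (hα : 0 < α)
    (hγ : ∀ r : ℕ, -((γ + 1) / α) ≠ (r : ℝ)) (hα1 : α ≤ 1) (hx : 0 < x)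
    (h2π : α = 1 → x < 2 * Real.pi) :
    HasSum (zetaTerm a γ α x) ((expSeries a γ α x - gammaTerm γ α x : ℝ) : ℂ) :=
  (hasSum_expansionTerm ha hα hα1 hx h2π
    (hasSum_incompleteTerm_of_ne hα hx (by positivity) hγ)).congr_fun fun k =>
    (expansionTerm_eq_zetaTerm ha (by simp) (by simp) (by simp) x
      (add_one_ne_zero_of_ne hα (hγ k))).symm

theorem expansionTerm_eq_ite {a γ α : ℝ} {e : ℂ} (ha : 0 < a) (hα : 0 < α) (he0 : 0 ≤ e.re)
    (he : 0 < e.im) (he1 : ‖e‖ ≤ 1) {r : ℕ} (hr : -((γ + 1) / α) = (r : ℝ)) (x : ℝ) (k : ℕ) :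
    expansionTerm e a γ α x k = (if k = r then 0 else zetaTerm a γ α x k) +
      if k = r then (((-1) ^ r * x ^ r / Real.Gamma (r + 1) *
        (Real.log (a + 1 / 2) - deriv Real.Gamma a / Real.Gamma a) : ℝ) : ℂ) else 0 := by
  split_ifs with h
  · subst h
    rw [zero_add, expansionTerm_of_eq ha he0 he x]
    rw [← neg_div, div_eq_iff hα.ne'] at hr
    linarith
  · rw [add_zero, expansionTerm_eq_zetaTerm ha he0 he he1]
    refine add_one_ne_zero_of_ne hα ?_
    rw [hr]
    exact_mod_cast Ne.symm h

theorem hasSum_zetaTerm_of_eq {a γ α x : ℝ} (ha : 0 < a) (hα : 0 < α) {r : ℕ}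
    (hr : -((γ + 1) / α) = (r : ℝ)) (hα1 : α ≤ 1) (hx : 0 < x)
    (h2π : α = 1 → x < 2 * Real.pi) :
    HasSum (fun k => if k = r then 0 else zetaTerm a γ α x k)
      ((expSeries a γ α x - logTerm a α r x : ℝ) : ℂ) := by
  have h1 := hasSum_expansionTerm ha hα hα1 hx h2π
    (hasSum_incompleteTerm_of_eq hα hx (by positivity) hr)
  have h2 := hasSum_ite_eq r ((((-1) ^ r * x ^ r / Real.Gamma (r + 1) *
        (Real.log (a + 1 / 2) - deriv Real.Gamma a / Real.Gamma a) : ℝ) : ℂ))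
  have h3 := h1.sub h2
  have h4 : expSeries a γ α x - logTerm a α r x = expSeries a γ α x -
      (-1) ^ r * x ^ r / Real.Gamma (r + 1) * (-Real.log x / α +
        deriv Real.Gamma (r + 1) / Real.Gamma (r + 1) * (1 / α) - Real.log (a + 1 / 2)) -
      (-1) ^ r * x ^ r / Real.Gamma (r + 1) *
        (Real.log (a + 1 / 2) - deriv Real.Gamma a / Real.Gamma a) := by
    unfold logTerm
    ring
  rw [h4, Complex.ofReal_sub (expSeries a γ α x - _)]
  refine h3.congr_fun fun k => ?_
  rw [expansionTerm_eq_ite ha hα (by simp) (by simp) (by simp) hr x k, add_sub_cancel_right]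

theorem hasExpansionAtZero_logTerm {a γ α : ℝ} (ha : 0 < a) (hα : 0 < α) {r : ℕ}
    (hr : -((γ + 1) / α) = (r : ℝ)) :
    HasExpansionAtZero (expSeries a γ α) (logTerm a α r)
      (fun x k => if k = r then 0 else zetaTerm a γ α x k) := by
  obtain ⟨e, δ, h⟩ := exists_isDampingDirection hα
  intro N
  have h1 := expSeries_sub_isBigO h ha hα
    (fun x hx => hasSum_incompleteTerm_of_eq hα hx (by positivity) hr) N
  -- the multiple of `x ^ r` that belongs to the logarithmic term is negligible if `N ≤ r`
  set K : ℝ := (-1) ^ r / Real.Gamma (r + 1) *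
    (Real.log (a + 1 / 2) - deriv Real.Gamma a / Real.Gamma a) with hK
  have h2 : (fun x : ℝ => if r < N then (0 : ℂ) else ((K * x ^ r : ℝ) : ℂ)) =O[𝓝[>] (0 : ℝ)]
      fun x : ℝ => x ^ N := by
    split_ifs with hN
    · exact isBigO_zero _ _
    · refine IsBigO.of_bound |K| ?_
      filter_upwards [Ioo_mem_nhdsGT (zero_lt_one' ℝ)] with x hx
      rw [Complex.norm_real, norm_mul, Real.norm_eq_abs, norm_pow, norm_pow,
        Real.norm_of_nonneg hx.1.le]
      have := pow_le_pow_of_le_one hx.1.le hx.2.le (not_lt.mp hN)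
      gcongr
  refine (h1.sub h2).congr_left fun x => ?_
  simp_rw [expansionTerm_eq_ite ha hα h.re_nonneg h.im_pos h.norm_le_one hr x]
  rw [Finset.sum_add_distrib, Finset.sum_ite_eq']
  have e1 : (-1) ^ r * x ^ r / Real.Gamma (r + 1) *
      (Real.log (a + 1 / 2) - deriv Real.Gamma a / Real.Gamma a) = K * x ^ r := by
    rw [hK]; ring
  have e2 : logTerm a α r x = (-1) ^ r * x ^ r / Real.Gamma (r + 1) * (-Real.log x / α +
      deriv Real.Gamma (r + 1) / Real.Gamma (r + 1) * (1 / α) - Real.log (a + 1 / 2)) +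
      K * x ^ r := by
    rw [← e1]
    unfold logTerm
    ring
  rw [e1, e2]
  simp only [Finset.mem_range]
  split_ifs with hN
  · push_cast
    ring
  · push_cast
    ring

theorem theorem1p1 (a γ α : ℝ) (ha : 0 < a) (hα : 0 < α) :
    (∀ x : ℝ, 0 < x → Summable (expTerm a γ α x)) ∧
    ((∀ r : ℕ, -((γ + 1) / α) ≠ (r : ℝ)) →
      HasExpansionAtZero (expSeries a γ α) (gammaTerm γ α) (zetaTerm a γ α) ∧
      (α < 1 → ∀ x : ℝ, 0 < x →
        HasSum (zetaTerm a γ α x) ((expSeries a γ α x - gammaTerm γ α x : ℝ) : ℂ)) ∧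
      (α = 1 → ∀ x : ℝ, 0 < x → x < 2 * Real.pi →
        HasSum (zetaTerm a γ α x) ((expSeries a γ α x - gammaTerm γ α x : ℝ) : ℂ))) ∧
    (∀ r : ℕ, -((γ + 1) / α) = (r : ℝ) →
      HasExpansionAtZero (expSeries a γ α) (logTerm a α r)
        (fun x k => if k = r then 0 else zetaTerm a γ α x k) ∧
      (α < 1 → ∀ x : ℝ, 0 < x →
        HasSum (fun k => if k = r then 0 else zetaTerm a γ α x k)
          ((expSeries a γ α x - logTerm a α r x : ℝ) : ℂ)) ∧
      (α = 1 → ∀ x : ℝ, 0 < x → x < 2 * Real.pi →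
        HasSum (fun k => if k = r then 0 else zetaTerm a γ α x k)
          ((expSeries a γ α x - logTerm a α r x : ℝ) : ℂ))) := by
  refine ⟨fun x hx => summable_expTerm γ ha hα hx, fun hγ => ⟨?_, ?_, ?_⟩, fun r hr => ⟨?_, ?_, ?_⟩⟩
  · exact hasExpansionAtZero_gammaTerm ha hα hγ
  · exact fun h1 x hx => hasSum_zetaTerm ha hα hγ h1.le hx fun h => absurd h h1.ne
  · exact fun h1 x hx h2 => hasSum_zetaTerm ha hα hγ h1.le hx fun _ => h2
  · exact hasExpansionAtZero_logTerm ha hα hr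
  · exact fun h1 x hx => hasSum_zetaTerm_of_eq ha hα hr h1.le hx fun h => absurd h h1.ne
  · exact fun h1 x hx h2 => hasSum_zetaTerm_of_eq ha hα hr h1.le hx fun _ => h2
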